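/- **Notation.** Let $\bar A=(A_0,A_1)$ be a compatible couple of quasi-Banach spaces (both continuously embedded in one Hausdorff topological vector space) with $A_0\cap A_1\ne\{0\}$, and let $K(t,f)=K(t,f;A_0,A_1)=\inf\{\|f_0\|_{A_0}+t\|f_1\|_{A_1}: f=f_0+f_1,\ f_i\in A_i\}$. A positive Lebesgue measurable function $b$ on $(0,\infty)$ is slowly varying ($b\in SV$) if for every $\varepsilon>0$ the function $t^{\varepsilon}b(t)$ is equivalent to a non-decreasing function and $t^{-\varepsilon}b(t)$ is equivalent to a non-increasing function (equivalence means two-sided bounds up to a positive constant). $\|\cdot\|_{q,(\alpha,\beta)}$ is the usual (quasi-)norm of $L_q(\alpha,\beta)$, $0<q\le\infty$, and $1/\infty=0$. For $0\le\theta\le1$ the spaces below consist of all $f\in A_0+A_1$ for which the indicated quasi-norm is finite: - $\bar A_{\theta,q;b}$: $\ \|u^{-\theta-1/q}b(u)K(u,f)\|_{q,(0,\infty)}$; - $\bar A^{\mathcal L}_{\theta,r,b,q,a}$: $\ \big\|t^{-1/r}b(t)\|u^{-\theta-1/q}a(u)K(u,f)\|_{q,(0,t)}\big\|_{r,(0,\infty)}$;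 - $\bar A^{\mathcal R}_{\theta,r,b,q,a}$: $\ \big\|t^{-1/r}b(t)\|u^{-\theta-1/q}a(u)K(u,f)\|_{q,(t,\infty)}\big\|_{r,(0,\infty)}$; - $\bar A^{\mathcal L,\mathcal L}_{\theta,s,c,r,b,q,a}$: $\ \Big\|t^{-1/s}c(t)\big\|u^{-1/r}b(u)\|v^{-\theta-1/q}a(v)K(v,f)\|_{q,(0,u)}\big\|_{r,(0,t)}\Big\|_{s,(0,\infty)}$; - $\bar A^{\mathcal R,\mathcal R}_{\theta,s,c,r,b,q,a}$: $\ \Big\|t^{-1/s}c(t)\big\|u^{-1/r}b(u)\|v^{-\theta-1/q}a(v)K(v,f)\|_{q,(u,\infty)}\big\|_{r,(t,\infty)}\Big\|_{s,(0,\infty)}$. For a couple $(Y_0,Y_1)$ of such spaces, $(Y_0,Y_1)_{\theta,r;a}$ is defined in the same way from the functional $K(t,f;Y_0,Y_1)$. Equality of spaces means that they have the same elements and equivalent quasi-norms. **Theorem.** Let $0<r,r_0,q_0,r_1,q_1\le\infty$ and $a,a_0,b_0,a_1,b_1\in SV$, and suppose $$\big\|s^{-1/r_0}b_0(s)\|u^{-1/q_0}a_0(u)\|_{q_0,(1,s)}\big\|_{r_0,(1,\infty)}<\infty,\qquad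 \big\|s^{-1/r_1}b_1(s)\|u^{-1/q_1}a_1(u)\|_{q_1,(s,1)}\big\|_{r_1,(0,1)}<\infty .$$ Put $$\chi_0(t)=\big\|s^{-1/r_0}b_0(s)\|u^{-1/q_0}a_0(u)\|_{q_0,(t,s)}\big\|_{r_0,(t,\infty)},\qquad \chi_1(t)=\big\|s^{-1/r_1}b_1(s)\|u^{-1/q_1}a_1(u)\|_{q_1,(s,t)}\big\|_{r_1,(0,t)},$$ $\rho(t)=t\,\chi_0(t)/\chi_1(t)$ and, for $0\le\theta\le1$, $a^\#=a^\#_\theta=\chi_0^{1-\theta}\chi_1^{\theta}\,(a\circ\rho)$. Let $Y_0=\bar A^{\mathcal L}_{0,r_0,b_0,q_0,a_0}$ and $Y_1=\bar A^{\mathcal R}_{1,r_1,b_1,q_1,a_1}$. (i) If $0<\theta<1$, then $(Y_0,Y_1)_{\theta,r;a}=\bar A_{\theta,r;a^\#}$. (ii) If $\|s^{-1/r}a(s)\|_{r,(1,\infty)}<\infty$, then $$(Y_0,Y_1)_{0,r;a}=\bar A_{0,r;a^\#}\cap\bar A^{\mathcal L}_{0,r,B_0,q_0,a_0}\cap\bar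 A^{\mathcal L,\mathcal L}_{0,r,a\circ\rho,r_0,b_0,q_0,a_0},\qquad B_0(t)=\|s^{-1/r_0}b_0(s)\|_{r_0,(t,\infty)}\,a(\rho(t)).$$ (iii) If $\|s^{-1/r}a(s)\|_{r,(0,1)}<\infty$, then $$(Y_0,Y_1)_{1,r;a}=\bar A_{1,r;a^\#}\cap\bar A^{\mathcal R}_{1,r,B_1,q_1,a_1}\cap\bar A^{\mathcal R,\mathcal R}_{1,r,a\circ\rho,r_1,b_1,q_1,a_1},\qquad B_1(t)=\|s^{-1/r_1}b_1(s)\|_{r_1,(0,t)}\,a(\rho(t)).$$ -/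

import Mathlib

open MeasureTheory Set Filter Topology
open scoped ENNReal NNReal

noncomputable section

/-! Spaces are described by extended quasi-norms: a functional `N : X → ℝ≥0∞` on an ambient vector
space `X` stands for the space `{f | N f < ∞}`, (quasi-)normed by `N`. -/

/-- The functional `N` is the (extended) quasi-norm of a quasi-Banach space over `𝕜` which is
continuously embedded in the topological vector space `X`. -/
structure IsQuasiBanach (𝕜 : Type*) {X : Type*} [RCLike 𝕜] [AddCommGroup X] [Module 𝕜 X]
    [TopologicalSpace X] (N : X → ℝ≥0∞) : Prop where
  eq_zero_iff : ∀ x, N x = 0 ↔ x = 0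
  smul : ∀ (c : 𝕜) (x : X), N (c • x) = ‖c‖ₑ * N x
  quasi_triangle : ∃ C : ℝ≥0, ∀ x y, N (x + y) ≤ C * (N x + N y)
  complete : ∀ u : ℕ → X, (∀ n, N (u n) < ∞) →
    (∀ ε : ℝ≥0∞, 0 < ε → ∃ n₀, ∀ m, n₀ ≤ m → ∀ n, n₀ ≤ n → N (u m - u n) < ε) →
    ∃ x, N x < ∞ ∧ Tendsto (fun n => N (u n - x)) atTop (𝓝 0)
  continuous_embedding : ∀ U ∈ 𝓝 (0 : X), ∃ δ : ℝ≥0∞, 0 < δ ∧ ∀ x, N x < δ → x ∈ U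

/-- `(A₀, A₁)` is a compatible couple of quasi-Banach spaces with `A₀ ∩ A₁ ≠ {0}`: both spaces are
continuously embedded in the same topological vector space `X` (assumed to be Hausdorff where this
is used). -/
structure IsCompatibleCouple (𝕜 : Type*) {X : Type*} [RCLike 𝕜] [AddCommGroup X] [Module 𝕜 X]
    [TopologicalSpace X] (A₀ A₁ : X → ℝ≥0∞) : Prop where
  left : IsQuasiBanach 𝕜 A₀
  right : IsQuasiBanach 𝕜 A₁
  inter_nontrivial : ∃ x, x ≠ 0 ∧ A₀ x < ∞ ∧ A₁ x < ∞

/-- The continuous embedding of the space of `N` into the space of `M`. -/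
def ContEmbedded {X : Type*} (N M : X → ℝ≥0∞) : Prop :=
  ∃ C : ℝ≥0, ∀ f, N f < ∞ → M f ≤ C * N f

/-- Equality of spaces: the same elements, with equivalent quasi-norms. -/
def SameSpace {X : Type*} (N M : X → ℝ≥0∞) : Prop :=
  ContEmbedded N M ∧ ContEmbedded M N

/-- The quasi-norm of the intersection of two spaces. -/
def interNorm {X : Type*} (N M : X → ℝ≥0∞) : X → ℝ≥0∞ := fun f => max (N f) (M f)

/-- Peetre's `K`-functional `K(t, f; A₀, A₁)`; it is `∞` if `f ∉ A₀ + A₁`. -/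
def peetreK {X : Type*} [AddCommGroup X] (A₀ A₁ : X → ℝ≥0∞) (t : ℝ) (f : X) : ℝ≥0∞ :=
  ⨅ (f₀ : X) (f₁ : X) (_ : f = f₀ + f₁), A₀ f₀ + ENNReal.ofReal t * A₁ f₁

/-- The usual (quasi-)norm in `L_q` on `I`, of a function with values in `[0, ∞]`. -/
def lqNorm (q : ℝ≥0∞) (I : Set ℝ) (F : ℝ → ℝ≥0∞) : ℝ≥0∞ := eLpNorm F q (volume.restrict I)

/-- Equivalence of two functions on `(0, ∞)`. -/
def EquivOnPos (f g : ℝ → ℝ) : Prop :=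
  ∃ C : ℝ, 0 < C ∧ ∀ t, 0 < t → f t ≤ C * g t ∧ g t ≤ C * f t

/-- Slowly varying functions on `(0, ∞)` (values outside of `(0, ∞)` are irrelevant). -/
structure SlowlyVarying (b : ℝ → ℝ) : Prop where
  pos : ∀ t, 0 < t → 0 < b t
  measurable : AEMeasurable b (volume.restrict (Ioi 0))
  equiv_increasing : ∀ ε : ℝ, 0 < ε →
    ∃ g : ℝ → ℝ, MonotoneOn g (Ioi 0) ∧ EquivOnPos (fun t => t ^ ε * b t) g
  equiv_decreasing : ∀ ε : ℝ, 0 < ε →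
    ∃ g : ℝ → ℝ, AntitoneOn g (Ioi 0) ∧ EquivOnPos (fun t => t ^ (-ε) * b t) g

/-- `‖u^{λ - 1/q} b(u) F(u)‖_{q, I}`, where `1/∞ = 0`. -/
def weightedNorm (l : ℝ) (q : ℝ≥0∞) (b : ℝ → ℝ) (I : Set ℝ) (F : ℝ → ℝ≥0∞) : ℝ≥0∞ :=
  lqNorm q I (fun u => ENNReal.ofReal (u ^ (l - q⁻¹.toReal) * b u) * F u)

section Spaces

variable {X : Type*} [AddCommGroup X]

/-- The space `(A₀, A₁)_{θ,q;b}`. As the weight is positive, the norm of an `f` outside of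
`A₀ + A₁` is `∞` here and in the next definitions. -/
def interp (A₀ A₁ : X → ℝ≥0∞) (θ : ℝ) (q : ℝ≥0∞) (b : ℝ → ℝ) : X → ℝ≥0∞ := fun f =>
  weightedNorm (-θ) q b (Ioi 0) (fun u => peetreK A₀ A₁ u f)

/-- The space `(A₀, A₁)^𝓛_{θ,r,b,q,a}`. -/
def interpL (A₀ A₁ : X → ℝ≥0∞) (θ : ℝ) (r : ℝ≥0∞) (b : ℝ → ℝ) (q : ℝ≥0∞) (a : ℝ → ℝ) :
    X → ℝ≥0∞ := fun f =>
  weightedNorm 0 r b (Ioi 0) fun t =>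
    weightedNorm (-θ) q a (Ioo 0 t) fun u => peetreK A₀ A₁ u f

/-- The space `(A₀, A₁)^𝓡_{θ,r,b,q,a}`. -/
def interpR (A₀ A₁ : X → ℝ≥0∞) (θ : ℝ) (r : ℝ≥0∞) (b : ℝ → ℝ) (q : ℝ≥0∞) (a : ℝ → ℝ) :
    X → ℝ≥0∞ := fun f =>
  weightedNorm 0 r b (Ioi 0) fun t =>
    weightedNorm (-θ) q a (Ioi t) fun u => peetreK A₀ A₁ u f

/-- The space `(A₀, A₁)^{𝓛,𝓛}_{θ,s,c,r,b,q,a}`. -/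
def interpLL (A₀ A₁ : X → ℝ≥0∞) (θ : ℝ) (s : ℝ≥0∞) (c : ℝ → ℝ) (r : ℝ≥0∞) (b : ℝ → ℝ)
    (q : ℝ≥0∞) (a : ℝ → ℝ) : X → ℝ≥0∞ := fun f =>
  weightedNorm 0 s c (Ioi 0) fun t =>
    weightedNorm 0 r b (Ioo 0 t) fun u =>
      weightedNorm (-θ) q a (Ioo 0 u) fun v => peetreK A₀ A₁ v f

/-- The space `(A₀, A₁)^{𝓡,𝓡}_{θ,s,c,r,b,q,a}`. -/
def interpRR (A₀ A₁ : X → ℝ≥0∞) (θ : ℝ) (s : ℝ≥0∞) (c : ℝ → ℝ) (r : ℝ≥0∞) (b : ℝ → ℝ)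
    (q : ℝ≥0∞) (a : ℝ → ℝ) : X → ℝ≥0∞ := fun f =>
  weightedNorm 0 s c (Ioi 0) fun t =>
    weightedNorm 0 r b (Ioi t) fun u =>
      weightedNorm (-θ) q a (Ioi u) fun v => peetreK A₀ A₁ v f

end Spaces

end

noncomputable section

/-! ### The (quasi-)norm of `L_q` -/

/-! The substitution t = e^x absorbs the factors u^{-1/q}: all norms become L_q norms for dx on ℝ,
slow variation becomes growth slower than every exponential (`Slow`), and k(x) = K(e^x, f) is
increasing with e^{-x} k(x) decreasing. Such functions change by bounded factors over bounded
distances (`Grow`). This replaces convexity and measurability: every exponent in (0, ∞] is allowed,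
functions are replaced by measurable equivalents, and norms are compared by Schur's test. The
reflection of k into e^x k(-x) exchanges 𝓛 at θ = 0 with 𝓡 at θ = 1, so one set of estimates
(`IterData`) serves both spaces: D stands for Y₀ and E for the reflected Y₁.

The core is a Holmstedt formula (`logK_norm_dominated`, `dominated_logK_norm`): with t = e^x,
K(ρ(t), f; Y₀, Y₁) is equivalent to D.trunc k (x) + ρ(t) E.trunc (reflect k) (-x). For the upper
bound, a nearly optimal decomposition of f at t has summands whose K-functionals are truncations of
k. For the lower bound, truncated norms are quasi-additive, and the norm of each of the two spaces
controls the truncated norm attached to the other: a finite norm in Y₁ forces k ≤ c h with h(u) =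
e^u / χ₁(e^u), and Hardy's inequality bounds D.trunc h by χ₀ h (`chi_mul_trunc_dominated`).

Next, p(x) = log ρ(e^x) is x plus a function whose oscillation is sublinear, so composition with p
preserves norms up to constants (`lqNorm_comp_dominated`, `lqNorm_dominated_comp`). Finally Hardy's
inequality (`Grow.truncNorm_hardy`) absorbs truncated norms into χ₀ k: both of them if 0 < θ < 1,
only the right one if θ = 0, only the left one if θ = 1. The three terms of the truncated norm that
remains give the three intersected spaces. -/

theorem lqNorm_top (I : Set ℝ) (F : ℝ → ℝ≥0∞) :
    lqNorm ∞ I F = essSup F (volume.restrict I) := by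
  simp [lqNorm, eLpNormEssSup]

theorem lqNorm_eq {q : ℝ≥0∞} (hq : 0 < q) (hq' : q ≠ ∞) (I : Set ℝ) (F : ℝ → ℝ≥0∞) :
    lqNorm q I F = (∫⁻ x in I, F x ^ q.toReal) ^ (1 / q.toReal) := by
  simp [lqNorm, eLpNorm_eq_lintegral_rpow_enorm_toReal hq.ne' hq']

theorem lqNorm_mono {q : ℝ≥0∞} {I : Set ℝ} (hI : MeasurableSet I) {F G : ℝ → ℝ≥0∞}
    (h : ∀ x ∈ I, F x ≤ G x) : lqNorm q I F ≤ lqNorm q I G := by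
  refine eLpNorm_mono_enorm_ae ?_
  filter_upwards [ae_restrict_mem hI] with x hx
  simpa using h x hx

theorem lqNorm_mono_set {q : ℝ≥0∞} {I J : Set ℝ} (h : I ⊆ J) (F : ℝ → ℝ≥0∞) :
    lqNorm q I F ≤ lqNorm q J F :=
  eLpNorm_mono_measure _ (Measure.restrict_mono_set _ h)

/-- This direction needs neither measurability of F nor finiteness of c; in the equality
`lqNorm_const_mul`, finiteness of c takes the place of measurability. -/
theorem mul_lqNorm_le {q : ℝ≥0∞} (hq : 0 < q) (I : Set ℝ) (c : ℝ≥0∞) (F : ℝ → ℝ≥0∞) :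
    c * lqNorm q I F ≤ lqNorm q I (fun x => c * F x) := by
  by_cases hq' : q = ∞
  · subst hq'
    rw [lqNorm_top, lqNorm_top, ENNReal.essSup_const_mul]
  · have h := ENNReal.toReal_pos hq.ne' hq'
    rw [lqNorm_eq hq hq', lqNorm_eq hq hq']
    simp_rw [ENNReal.mul_rpow_of_nonneg _ _ h.le]
    calc c * (∫⁻ x in I, F x ^ q.toReal) ^ (1 / q.toReal)
        = (c ^ q.toReal * ∫⁻ x in I, F x ^ q.toReal) ^ (1 / q.toReal) := by
          rw [ENNReal.mul_rpow_of_nonneg _ _ (by positivity), ← ENNReal.rpow_mul,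
            mul_one_div_cancel h.ne', ENNReal.rpow_one]
      _ ≤ _ := ENNReal.rpow_le_rpow (lintegral_const_mul_le _ _) (by positivity)

theorem lqNorm_const_mul {q : ℝ≥0∞} (hq : 0 < q) (I : Set ℝ) {c : ℝ≥0∞} (hc : c ≠ ∞)
    (F : ℝ → ℝ≥0∞) : lqNorm q I (fun x => c * F x) = c * lqNorm q I F := by
  by_cases hq' : q = ∞
  · subst hq'
    rw [lqNorm_top, lqNorm_top, ENNReal.essSup_const_mul]
  · have h := ENNReal.toReal_pos hq.ne' hq'
    rw [lqNorm_eq hq hq', lqNorm_eq hq hq']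
    simp_rw [ENNReal.mul_rpow_of_nonneg _ _ h.le]
    rw [lintegral_const_mul' _ _ (ENNReal.rpow_ne_top_of_nonneg h.le hc),
      ENNReal.mul_rpow_of_nonneg _ _ (by positivity), ← ENNReal.rpow_mul,
      mul_one_div_cancel h.ne', ENNReal.rpow_one]

theorem lqNorm_mul_const {q : ℝ≥0∞} (hq : 0 < q) (I : Set ℝ) {c : ℝ≥0∞} (hc : c ≠ ∞)
    (F : ℝ → ℝ≥0∞) : lqNorm q I (fun x => F x * c) = lqNorm q I F * c := by
  simp_rw [mul_comm _ c]
  exact lqNorm_const_mul hq I hc F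

theorem lqNorm_le_mul {q : ℝ≥0∞} (hq : 0 < q) {I : Set ℝ} (hI : MeasurableSet I) {c : ℝ≥0∞}
    (hc : c ≠ ∞) {F G : ℝ → ℝ≥0∞} (h : ∀ x ∈ I, F x ≤ c * G x) :
    lqNorm q I F ≤ c * lqNorm q I G :=
  (lqNorm_mono hI h).trans (lqNorm_const_mul hq I hc G).le

theorem lqNorm_one_ne_zero {q : ℝ≥0∞} (hq : 0 < q) {I : Set ℝ} (hI : volume I ≠ 0) :
    lqNorm q I (fun _ => 1) ≠ 0 := by
  rw [lqNorm, eLpNorm_const _ hq.ne' (by simpa using hI)]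
  simp only [enorm_eq_self, one_mul, MeasurableSet.univ, Measure.restrict_apply, univ_inter]
  rw [Ne, ENNReal.rpow_eq_zero_iff]
  rintro (⟨h, -⟩ | ⟨-, h⟩)
  · exact hI h
  · have : 0 ≤ 1 / q.toReal := by positivity
    linarith

theorem lqNorm_one_ne_top {q : ℝ≥0∞} {I : Set ℝ} (hI : volume I ≠ ∞) :
    lqNorm q I (fun _ => 1) ≠ ∞ := by
  by_cases hq : q = 0
  · simp [lqNorm, hq]
  by_cases hI' : volume I = 0
  · simp [lqNorm, Measure.restrict_eq_zero.2 hI']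
  rw [lqNorm, eLpNorm_const _ hq (by simpa using hI')]
  simp only [enorm_eq_self, one_mul, MeasurableSet.univ, Measure.restrict_apply, univ_inter]
  exact ENNReal.rpow_ne_top_of_nonneg (by positivity) hI

/-- The quasi-norm of `L_q` is computed up to a constant on two pieces of the set. -/
theorem exists_lqNorm_union_le {q : ℝ≥0∞} (hq : 0 < q) : ∃ C : ℝ≥0, ∀ (I J : Set ℝ)
    (F : ℝ → ℝ≥0∞), lqNorm q (I ∪ J) F ≤ C * (lqNorm q I F + lqNorm q J F) := by
  by_cases hq' : q = ∞
  · refine ⟨1, fun I J F => ?_⟩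
    subst hq'
    simp only [lqNorm_top, ENNReal.coe_one, one_mul]
    refine essSup_le_of_ae_le _ ?_
    refine (ae_restrict_union_iff _ _ _).2 ⟨?_, ?_⟩
    · filter_upwards [ENNReal.ae_le_essSup F] with x hx using hx.trans le_self_add
    · filter_upwards [ENNReal.ae_le_essSup F] with x hx using hx.trans le_add_self
  · have h := ENNReal.toReal_pos hq.ne' hq'
    refine ⟨2 ^ (1 / q.toReal), fun I J F => ?_⟩
    rw [lqNorm_eq hq hq', lqNorm_eq hq hq', lqNorm_eq hq hq']
    set A := ∫⁻ x in I, F x ^ q.toReal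
    set B := ∫⁻ x in J, F x ^ q.toReal
    have h2 : (0 : ℝ) ≤ 1 / q.toReal := by positivity
    calc _ ≤ (A + B) ^ (1 / q.toReal) :=
          ENNReal.rpow_le_rpow (lintegral_union_le _ _ _) h2
      _ ≤ (2 * max A B) ^ (1 / q.toReal) := by
          refine ENNReal.rpow_le_rpow ?_ h2
          rw [two_mul]
          exact add_le_add (le_max_left _ _) (le_max_right _ _)
      _ = 2 ^ (1 / q.toReal) * (max A B) ^ (1 / q.toReal) :=
          ENNReal.mul_rpow_of_nonneg _ _ h2
      _ = 2 ^ (1 / q.toReal) * max (A ^ (1 / q.toReal)) (B ^ (1 / q.toReal)) := by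
          rw [(ENNReal.monotone_rpow_of_nonneg h2).map_max]
      _ ≤ _ := by
          rw [ENNReal.coe_rpow_of_nonneg _ h2]
          exact mul_le_mul' le_rfl (max_le le_self_add le_add_self)

theorem exists_lqNorm_add_le (q : ℝ≥0∞) : ∃ C : ℝ≥0, ∀ (I : Set ℝ) (F G : ℝ → ℝ≥0∞),
    Measurable F → Measurable G →
    lqNorm q I (fun x => F x + G x) ≤ C * (lqNorm q I F + lqNorm q I G) := by
  refine ⟨(ENNReal.LpAddConst q).toNNReal, fun I F G hF hG => ?_⟩
  rw [ENNReal.coe_toNNReal (ENNReal.LpAddConst_lt_top q).ne]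
  exact eLpNorm_add_le' hF.aestronglyMeasurable hG.aestronglyMeasurable q

theorem lqNorm_comp_equiv (q : ℝ≥0∞) (I : Set ℝ) (F : ℝ → ℝ≥0∞) (e : ℝ ≃ᵐ ℝ)
    (he : MeasurePreserving e) : lqNorm q (e ⁻¹' I) (fun x => F (e x)) = lqNorm q I F := by
  have h := (he.restrict_preimage_emb e.measurableEmbedding I).map_eq
  rw [lqNorm, lqNorm, ← h, e.measurableEmbedding.eLpNorm_map_measure]
  rfl

theorem lqNorm_comp_neg (q : ℝ≥0∞) (I : Set ℝ) (F : ℝ → ℝ≥0∞) :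
    lqNorm q (Neg.neg ⁻¹' I) (fun x => F (-x)) = lqNorm q I F :=
  lqNorm_comp_equiv q I F (MeasurableEquiv.neg ℝ) (Measure.measurePreserving_neg volume)

theorem lqNorm_comp_add (q : ℝ≥0∞) (I : Set ℝ) (F : ℝ → ℝ≥0∞) (c : ℝ) :
    lqNorm q ((fun x => x + c) ⁻¹' I) (fun x => F (x + c)) = lqNorm q I F :=
  lqNorm_comp_equiv q I F (MeasurableEquiv.addRight c) (measurePreserving_add_right volume c)

/-- The `L_q` version of Schur's test, with both exponents equal to `r`. -/
theorem lqNorm_le_of_kernel {r : ℝ≥0∞} (hr : 0 < r) {k : ℝ → ℝ → ℝ≥0∞} {M : ℝ≥0∞}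
    (hk : Measurable (Function.uncurry k)) (hM : M ≠ ∞) (hkM : ∀ x u, k x u ≤ M)
    (hkr : ∀ u, lqNorm r univ (fun x => k x u) ≤ M) {F G : ℝ → ℝ≥0∞} (hG : Measurable G)
    (h : ∀ x, F x ≤ lqNorm r univ (fun u => k x u * G u)) :
    lqNorm r univ F ≤ M * lqNorm r univ G := by
  by_cases hr' : r = ∞
  · subst hr'
    rw [lqNorm_top univ F]
    refine essSup_le_of_ae_le _ (Eventually.of_forall fun x => (h x).trans ?_)
    exact lqNorm_le_mul hr .univ hM fun u _ => mul_le_mul' (hkM x u) le_rfl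
  · have hp := ENNReal.toReal_pos hr.ne' hr'
    set p := r.toReal
    -- Raising to the power r turns the claim into Tonelli for r-th powers; Minkowski's inequality
    -- is not used, so r < 1 is covered.
    have key : ∫⁻ x, F x ^ p ≤ M ^ p * ∫⁻ u, G u ^ p := by
      calc ∫⁻ x, F x ^ p ≤ ∫⁻ x, ∫⁻ u, k x u ^ p * G u ^ p := by
            refine lintegral_mono fun x => ?_
            refine (ENNReal.rpow_le_rpow (h x) hp.le).trans_eq ?_
            rw [lqNorm_eq hr hr', ← ENNReal.rpow_mul, one_div, inv_mul_cancel₀ hp.ne',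
              ENNReal.rpow_one]
            rw [Measure.restrict_univ]
            simp only [ENNReal.mul_rpow_of_nonneg _ _ hp.le, p]
        _ = ∫⁻ u, ∫⁻ x, k x u ^ p * G u ^ p := by
            refine lintegral_lintegral_swap ?_
            exact ((hk.pow_const p).mul ((hG.comp measurable_snd).pow_const p)).aemeasurable
        _ = ∫⁻ u, (∫⁻ x, k x u ^ p) * G u ^ p := by
            refine lintegral_congr fun u => ?_
            exact lintegral_mul_const _ ((hk.comp (measurable_id.prodMk measurable_const)).pow_const p)
        _ ≤ ∫⁻ u, M ^ p * G u ^ p := by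
            refine lintegral_mono fun u => mul_le_mul' ?_ le_rfl
            have := hkr u
            rw [lqNorm_eq hr hr', Measure.restrict_univ, one_div,
              ENNReal.rpow_inv_le_iff hp] at this
            exact this
        _ = _ := lintegral_const_mul _ (hG.pow_const p)
    rw [lqNorm_eq hr hr', lqNorm_eq hr hr', Measure.restrict_univ]
    refine (ENNReal.rpow_le_rpow key (by positivity)).trans_eq ?_
    rw [ENNReal.mul_rpow_of_nonneg _ _ (by positivity), ← ENNReal.rpow_mul,
      mul_one_div_cancel hp.ne', ENNReal.rpow_one]

/-! ### Functions of at most exponential growth -/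

/-- The exponential function, with values in `[0, ∞]`. -/
def eexp (x : ℝ) : ℝ≥0∞ := ENNReal.ofReal (Real.exp x)

theorem eexp_add (x y : ℝ) : eexp (x + y) = eexp x * eexp y := by
  rw [eexp, Real.exp_add, ENNReal.ofReal_mul (Real.exp_pos x).le]; rfl

theorem eexp_ne_zero (x : ℝ) : eexp x ≠ 0 := by simp [eexp, Real.exp_pos]

theorem eexp_ne_top (x : ℝ) : eexp x ≠ ∞ := ENNReal.ofReal_ne_top

theorem eexp_zero : eexp 0 = 1 := by simp [eexp]

theorem eexp_le {x y : ℝ} (h : x ≤ y) : eexp x ≤ eexp y :=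
  ENNReal.ofReal_le_ofReal (Real.exp_le_exp.2 h)

theorem eexp_mul_neg (x : ℝ) : eexp x * eexp (-x) = 1 := by
  rw [← eexp_add, add_neg_cancel, eexp_zero]

theorem one_le_eexp {x : ℝ} (h : 0 ≤ x) : 1 ≤ eexp x := by
  rw [← eexp_zero]; exact eexp_le h

theorem continuous_eexp : Continuous eexp :=
  ENNReal.continuous_ofReal.comp Real.continuous_exp

theorem measurable_eexp : Measurable eexp := continuous_eexp.measurable

theorem coe_toNNReal_eexp (x : ℝ) : ((eexp x).toNNReal : ℝ≥0∞) = eexp x :=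
  ENNReal.coe_toNNReal (eexp_ne_top x)

theorem lqNorm_eexp_ne_top {q : ℝ≥0∞} (hq : 0 < q) {δ : ℝ} (hδ : 0 < δ) :
    lqNorm q (Iio 0) (fun u => eexp (δ * u)) ≠ ∞ := by
  by_cases hq' : q = ∞
  · subst hq'
    rw [lqNorm_top]
    refine ne_top_of_le_ne_top ENNReal.one_ne_top (essSup_le_of_ae_le _ ?_)
    filter_upwards [ae_restrict_mem measurableSet_Iio] with u hu
    rw [← eexp_zero]
    exact eexp_le (mul_nonpos_of_nonneg_of_nonpos hδ.le (le_of_lt hu))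
  · have h := ENNReal.toReal_pos hq.ne' hq'
    rw [lqNorm_eq hq hq']
    refine ENNReal.rpow_ne_top_of_nonneg (by positivity) ?_
    have h1 : ∀ u, eexp (δ * u) ^ q.toReal = ENNReal.ofReal (Real.exp ((δ * q.toReal) * u)) := by
      intro u
      rw [eexp, ENNReal.ofReal_rpow_of_pos (Real.exp_pos _), ← Real.exp_mul]
      ring_nf
    simp_rw [h1]
    have h2 := (integrableOn_exp_mul_Iic (mul_pos hδ h) 0).mono_set Iio_subset_Iic_self
    rw [← ofReal_integral_eq_lintegral_ofReal h2 (Eventually.of_forall fun u => (Real.exp_pos _).le)]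
    exact ENNReal.ofReal_ne_top

section Families

variable {ι : Type*}

/-- `F ≤ C G` with a constant `C` which does not depend on the point and on the index. -/
def Dominated (F G : ι → ℝ → ℝ≥0∞) : Prop := ∃ C : ℝ≥0, ∀ i x, F i x ≤ C * G i x

infix:50 " ≲ " => Dominated

/-- The functions of the family grow at most exponentially, in a uniform way. -/
def Grow (F : ι → ℝ → ℝ≥0∞) : Prop :=
  ∃ M : ℝ, 0 ≤ M ∧ ∃ C : ℝ≥0, ∀ i x y, F i x ≤ C * eexp (M * |x - y|) * F i y

/-- The function grows more slowly than any exponential function; this is slow variation in the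
logarithmic variable. -/
def Slow (w : ℝ → ℝ≥0∞) : Prop :=
  ∀ ε : ℝ, 0 < ε → ∃ C : ℝ≥0, ∀ x y, w x ≤ C * eexp (ε * |x - y|) * w y

variable {F G H F' G' : ι → ℝ → ℝ≥0∞}

theorem Dominated.of_le (h : ∀ i x, F i x ≤ G i x) : F ≲ G :=
  ⟨1, fun i x => by simpa using h i x⟩

theorem Dominated.refl (F : ι → ℝ → ℝ≥0∞) : F ≲ F := .of_le fun _ _ => le_rfl

theorem Dominated.trans (h : F ≲ G) (h' : G ≲ H) : F ≲ H := by
  obtain ⟨C, hC⟩ := h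
  obtain ⟨D, hD⟩ := h'
  refine ⟨C * D, fun i x => (hC i x).trans ?_⟩
  rw [ENNReal.coe_mul, mul_assoc]
  exact mul_le_mul' le_rfl (hD i x)

theorem Dominated.mul (h : F ≲ G) (h' : F' ≲ G') :
    (fun i x => F i x * F' i x) ≲ fun i x => G i x * G' i x := by
  obtain ⟨C, hC⟩ := h
  obtain ⟨D, hD⟩ := h'
  refine ⟨C * D, fun i x => (mul_le_mul' (hC i x) (hD i x)).trans_eq ?_⟩
  rw [ENNReal.coe_mul]
  ring

theorem Dominated.mul_left (w : ℝ → ℝ≥0∞) (h : F ≲ G) :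
    (fun i x => w x * F i x) ≲ fun i x => w x * G i x :=
  (Dominated.refl fun _ => w).mul h

theorem Dominated.add (h : F ≲ G) (h' : F' ≲ G') :
    (fun i x => F i x + F' i x) ≲ fun i x => G i x + G' i x := by
  obtain ⟨C, hC⟩ := h
  obtain ⟨D, hD⟩ := h'
  refine ⟨C + D, fun i x => (add_le_add (hC i x) (hD i x)).trans ?_⟩
  rw [mul_add, ENNReal.coe_add, add_mul, add_mul]
  exact add_le_add le_self_add le_add_self

theorem Dominated.add_le (h : F ≲ H) (h' : G ≲ H) : (fun i x => F i x + G i x) ≲ H := by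
  refine (h.add h').trans ⟨2, fun i x => ?_⟩
  simp [two_mul]

theorem Grow.of_slow {w : ℝ → ℝ≥0∞} (h : Slow w) : Grow fun _ : ι => w := by
  obtain ⟨C, hC⟩ := h 1 one_pos
  exact ⟨1, zero_le_one, C, fun _ => hC⟩

theorem mul_le_growth {C D : ℝ≥0} {M N z : ℝ} {a b a' b' : ℝ≥0∞} (h : a ≤ C * eexp (M * z) * b)
    (h' : a' ≤ D * eexp (N * z) * b') :
    a * a' ≤ (C * D : ℝ≥0) * eexp ((M + N) * z) * (b * b') := by
  refine (mul_le_mul' h h').trans_eq ?_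
  rw [add_mul, eexp_add, ENNReal.coe_mul]
  ring

theorem Grow.mul (hF : Grow F) (hG : Grow G) : Grow fun i x => F i x * G i x := by
  obtain ⟨M, hM, C, hC⟩ := hF
  obtain ⟨N, hN, D, hD⟩ := hG
  exact ⟨M + N, by positivity, C * D, fun i x y => mul_le_growth (hC i x y) (hD i x y)⟩

theorem Grow.add (hF : Grow F) (hG : Grow G) : Grow fun i x => F i x + G i x := by
  obtain ⟨M, hM, C, hC⟩ := hF
  obtain ⟨N, hN, D, hD⟩ := hG
  refine ⟨M + N, by positivity, C + D, fun i x y => ?_⟩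
  have h : ∀ (C' : ℝ≥0) (M' : ℝ), C' ≤ C + D → M' ≤ M + N →
      (C' : ℝ≥0∞) * eexp (M' * |x - y|) ≤ (C + D : ℝ≥0) * eexp ((M + N) * |x - y|) :=
    fun C' M' h1 h2 => mul_le_mul' (by exact_mod_cast h1)
      (eexp_le (mul_le_mul_of_nonneg_right h2 (abs_nonneg _)))
  rw [mul_add]
  exact add_le_add ((hC i x y).trans (mul_le_mul' (h C M le_self_add (by linarith)) le_rfl))
    ((hD i x y).trans (mul_le_mul' (h D N le_add_self (by linarith)) le_rfl))

theorem Slow.mul {v w : ℝ → ℝ≥0∞} (hv : Slow v) (hw : Slow w) : Slow fun x => v x * w x := by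
  intro ε hε
  obtain ⟨C, hC⟩ := hv (ε / 2) (by positivity)
  obtain ⟨D, hD⟩ := hw (ε / 2) (by positivity)
  refine ⟨C * D, fun x y => ?_⟩
  have := mul_le_growth (hC x y) (hD x y)
  rwa [add_halves] at this

theorem Slow.comp_neg {w : ℝ → ℝ≥0∞} (hw : Slow w) : Slow fun x => w (-x) := by
  intro ε hε
  obtain ⟨C, hC⟩ := hw ε hε
  refine ⟨C, fun x y => (hC (-x) (-y)).trans_eq ?_⟩
  rw [neg_sub_neg, abs_sub_comm]

theorem grow_eexp (θ : ℝ) : Grow fun (_ : ι) x => eexp (θ * x) := by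
  refine ⟨|θ|, abs_nonneg _, 1, fun _ x y => ?_⟩
  rw [ENNReal.coe_one, one_mul, ← eexp_add]
  refine eexp_le ?_
  have := le_abs_self (θ * (x - y))
  rw [abs_mul] at this
  linarith

/-- A family of functions of exponential growth is equivalent to a family of measurable
functions. -/
theorem Grow.exists_measurable (hF : Grow F) :
    ∃ G : ι → ℝ → ℝ≥0∞, (∀ i, Measurable (G i)) ∧ (∀ i x, F i x ≤ G i x) ∧ G ≲ F := by
  obtain ⟨M, hM, C, hC⟩ := hF
  -- An exponential sup-convolution: a supremum of continuous functions, hence lower semicontinuous;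
  -- it is at least F (take y = x) and, by the growth bound, at most C F.
  refine ⟨fun i x => ⨆ y, eexp (-(M * |x - y|)) * F i y, fun i => ?_, fun i x => ?_, C,
    fun i x => ?_⟩
  · refine (lowerSemicontinuous_iSup fun y => ?_).measurable
    refine Continuous.lowerSemicontinuous ?_
    by_cases h : F i y = ∞
    · simp only [h, ENNReal.mul_top (eexp_ne_zero _)]
      exact continuous_const
    · refine (ENNReal.continuous_mul_const h).comp (continuous_eexp.comp ?_)
      fun_prop
  · refine le_trans ?_ (le_iSup _ x)
    simp [eexp_zero]
  · refine iSup_le fun y => ?_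
    refine (mul_le_mul' le_rfl (hC i y x)).trans_eq ?_
    rw [abs_sub_comm y x]
    calc _ = (eexp (M * |x - y|) * eexp (-(M * |x - y|))) * (C * F i x) := by ring
      _ = _ := by rw [eexp_mul_neg, one_mul]

/-! ### The norm of `L_q` on families -/

theorem Dominated.comp_lqNorm {q : ℝ≥0∞} (hq : 0 < q) {S : ℝ → Set ℝ} (hS : ∀ x, MeasurableSet (S x))
    (h : F ≲ G) : (fun i x => lqNorm q (S x) (F i)) ≲ fun i x => lqNorm q (S x) (G i) := by
  obtain ⟨C, hC⟩ := h
  exact ⟨C, fun i x => lqNorm_le_mul hq (hS x) ENNReal.coe_ne_top fun u _ => hC i u⟩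

/-- The quasi-triangle inequality requires measurability, so it is applied to equivalent measurable
majorants. -/
theorem Grow.lqNorm_add {q : ℝ≥0∞} (hq : 0 < q) {S : ℝ → Set ℝ} (hS : ∀ x, MeasurableSet (S x))
    (hF : Grow F) (hG : Grow G) :
    (fun i x => lqNorm q (S x) (fun u => F i u + G i u)) ≲
      fun i x => lqNorm q (S x) (F i) + lqNorm q (S x) (G i) := by
  obtain ⟨F', hF', hFF', hF'F⟩ := hF.exists_measurable
  obtain ⟨G', hG', hGG', hG'G⟩ := hG.exists_measurable
  obtain ⟨C, hC⟩ := exists_lqNorm_add_le q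
  have h : (fun i x => lqNorm q (S x) (fun u => F i u + G i u)) ≲
      fun i x => lqNorm q (S x) (F' i) + lqNorm q (S x) (G' i) :=
    ⟨C, fun i x => (lqNorm_mono (hS x) fun u _ => add_le_add (hFF' i u) (hGG' i u)).trans
      (hC (S x) (F' i) (G' i) (hF' i) (hG' i))⟩
  exact h.trans ((hF'F.comp_lqNorm hq hS).add (hG'G.comp_lqNorm hq hS))

/-- The family of the functions `x ↦ ‖F i‖_{q,(-∞,x)}`. -/
def leftNorm (q : ℝ≥0∞) (F : ι → ℝ → ℝ≥0∞) : ι → ℝ → ℝ≥0∞ := fun i x => lqNorm q (Iio x) (F i)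

theorem Dominated.comp_leftNorm {q : ℝ≥0∞} (hq : 0 < q) (h : F ≲ G) :
    leftNorm q F ≲ leftNorm q G :=
  h.comp_lqNorm hq fun _ => measurableSet_Iio

theorem lqNorm_Iio_shift (q : ℝ≥0∞) (F : ℝ → ℝ≥0∞) (x y : ℝ) :
    lqNorm q (Iio x) F = lqNorm q (Iio y) fun u => F (u + (x - y)) := by
  rw [← lqNorm_comp_add q (Iio x) F (x - y)]
  congr 1
  ext u
  simp only [mem_preimage, mem_Iio]
  constructor <;> intro <;> linarith

/-- Moving the endpoint of the half-line amounts to translating the function, so the growth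
constants are inherited unchanged. -/
theorem Grow.comp_leftNorm {q : ℝ≥0∞} (hq : 0 < q) (hF : Grow F) : Grow (leftNorm q F) := by
  obtain ⟨M, hM, C, hC⟩ := hF
  refine ⟨M, hM, C, fun i x y => ?_⟩
  unfold leftNorm
  rw [lqNorm_Iio_shift q (F i) x y]
  refine lqNorm_le_mul hq measurableSet_Iio
    (ENNReal.mul_ne_top ENNReal.coe_ne_top (eexp_ne_top _)) fun u _ => ?_
  simpa using hC i (u + (x - y)) u

/-- On an interval of fixed length at bounded distance from x, F is comparable to F x. This converts
point values into local norms with any exponent. -/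
theorem Grow.dominated_lqNorm_Ioo {q : ℝ≥0∞} (hq : 0 < q) (hF : Grow F) {a b : ℝ} (hab : a < b) :
    F ≲ fun i x => lqNorm q (Ioo (x + a) (x + b)) (F i) := by
  obtain ⟨M, hM, C, hC⟩ := hF
  set c := lqNorm q (Ioo a b) fun _ => 1
  have hc0 : c ≠ 0 := lqNorm_one_ne_zero hq (by simpa using hab)
  have hct : c ≠ ∞ := lqNorm_one_ne_top (by simp)
  set D := (C : ℝ≥0∞) * eexp (M * (|a| + |b|))
  have hD : D ≠ ∞ := ENNReal.mul_ne_top ENNReal.coe_ne_top (eexp_ne_top _)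
  refine ⟨(c⁻¹ * D).toNNReal, fun i x => ?_⟩
  rw [ENNReal.coe_toNNReal (ENNReal.mul_ne_top (ENNReal.inv_ne_top.2 hc0) hD)]
  have hx : c = lqNorm q (Ioo (x + a) (x + b)) fun _ => 1 := by
    rw [← lqNorm_comp_add q (Ioo (x + a) (x + b)) _ x]
    simp [c]
  calc F i x = c⁻¹ * (F i x * c) := by
        rw [mul_comm (F i x), ← mul_assoc, ENNReal.inv_mul_cancel hc0 hct, one_mul]
    _ ≤ c⁻¹ * (D * lqNorm q (Ioo (x + a) (x + b)) (F i)) := by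
        refine mul_le_mul' le_rfl ?_
        rw [hx]
        refine (mul_lqNorm_le hq _ _ _).trans (lqNorm_le_mul hq measurableSet_Ioo hD ?_)
        intro v hv
        rw [mul_one]
        refine (hC i x v).trans (mul_le_mul' (mul_le_mul' le_rfl (eexp_le ?_)) le_rfl)
        refine mul_le_mul_of_nonneg_left ?_ hM
        rw [abs_le]
        have := neg_abs_le a
        have := le_abs_self b
        have := abs_nonneg a
        have := abs_nonneg b
        constructor <;> linarith [hv.1, hv.2]
    _ = _ := (mul_assoc _ _ _).symm

theorem Grow.dominated_lqNorm_univ {q : ℝ≥0∞} (hq : 0 < q) (hF : Grow F) :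
    F ≲ fun i _ => lqNorm q univ (F i) :=
  (hF.dominated_lqNorm_Ioo hq zero_lt_one).trans (.of_le fun _ _ => lqNorm_mono_set (subset_univ _) _)

theorem Grow.dominated_of_kernel {r : ℝ≥0∞} (hr : 0 < r) {k : ℝ → ℝ → ℝ≥0∞} {M : ℝ≥0∞}
    (hk : Measurable (Function.uncurry k)) (hM : M ≠ ∞) (hkM : ∀ x u, k x u ≤ M)
    (hkr : ∀ u, lqNorm r univ (fun x => k x u) ≤ M) (hG : Grow G)
    (h : F ≲ fun i x => lqNorm r univ (fun u => k x u * G i u)) :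
    (fun i (_ : ℝ) => lqNorm r univ (F i)) ≲ fun i _ => lqNorm r univ (G i) := by
  obtain ⟨C, hC⟩ := h
  obtain ⟨G', hG', hGG', hG'G⟩ := hG.exists_measurable
  refine Dominated.trans (G := fun i _ => lqNorm r univ (G' i)) ⟨C * M.toNNReal, fun i _ => ?_⟩
    (hG'G.comp_lqNorm hr fun _ => .univ)
  rw [ENNReal.coe_mul, ENNReal.coe_toNNReal hM, mul_assoc]
  refine (lqNorm_le_mul hr .univ ENNReal.coe_ne_top fun x _ => hC i x).trans ?_
  refine mul_le_mul' le_rfl (lqNorm_le_of_kernel hr hk hM hkM hkr (hG' i) fun x => ?_)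
  exact lqNorm_mono .univ fun u _ => mul_le_mul' le_rfl (hGG' i u)

/-! ### Hardy's inequality -/

theorem lqNorm_Iio_eexp (q : ℝ≥0∞) (δ x : ℝ) :
    lqNorm q (Iio x) (fun u => eexp (-(δ * (x - u)))) = lqNorm q (Iio 0) fun u => eexp (δ * u) := by
  rw [lqNorm_Iio_shift q _ x 0]
  congr 1
  funext u
  congr 1
  ring

theorem lqNorm_Ioi_eexp (q : ℝ≥0∞) (δ u : ℝ) :
    lqNorm q (Ioi u) (fun x => eexp (-(δ * (x - u)))) = lqNorm q (Iio 0) fun u => eexp (δ * u) := by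
  rw [← lqNorm_Iio_eexp q δ (-u), ← lqNorm_comp_neg q (Ioi u)]
  congr 1
  · ext x
    simp only [mem_preimage, mem_Ioi, mem_Iio]
    constructor <;> intro <;> linarith
  · ext x
    congr 1
    ring

/-- For functions of exponential growth, the exponent may be changed at the cost of a small loss in
the exponential weight. -/
theorem Grow.leftNorm_eexp_dominated {q r : ℝ≥0∞} (hq : 0 < q) (hr : 0 < r) (hG : Grow G) {δ : ℝ}
    (hδ : 0 < δ) :
    (fun i x => lqNorm q (Iio x) fun u => eexp (-(2 * δ * (x - u))) * G i u) ≲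
      fun i x => lqNorm r (Iio x) fun u => eexp (-(δ * (x - u))) * G i u := by
  obtain ⟨C, hC⟩ := hG.dominated_lqNorm_Ioo hr (a := -1) (b := 0) (by norm_num)
  set K := lqNorm q (Iio 0) fun u => eexp (δ * u)
  have hK : K ≠ ∞ := lqNorm_eexp_ne_top hq hδ
  -- The summand 1 keeps the constant nonzero, so that the bound is trivial when R = ∞.
  refine ⟨K.toNNReal * (C * (eexp δ).toNNReal) + 1, fun i x => ?_⟩
  set R := lqNorm r (Iio x) fun u => eexp (-(δ * (x - u))) * G i u
  by_cases hR : R = ∞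
  · refine le_top.trans_eq (Eq.symm ?_)
    change _ * R = ∞
    rw [hR, ENNReal.mul_top (by simp)]
  -- One half of the exponential weight serves for this pointwise bound, through the norm over (u -
  -- 1, u); the other half remains to make the q-norm converge.
  have h1 : ∀ u ∈ Iio x, eexp (-(δ * (x - u))) * G i u ≤ C * eexp δ * R := by
    intro u hu
    have h2 : eexp (-(δ * (x - u))) * lqNorm r (Ioo (u + -1) (u + 0)) (G i) ≤ eexp δ * R := by
      refine (mul_lqNorm_le hr _ _ _).trans ?_
      refine (lqNorm_le_mul hr measurableSet_Ioo (eexp_ne_top δ) (G := fun v =>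
        eexp (-(δ * (x - v))) * G i v) fun v hv => ?_).trans
        (mul_le_mul' le_rfl (lqNorm_mono_set (fun v hv => ?_) _))
      · rw [← mul_assoc, ← eexp_add]
        refine mul_le_mul' (eexp_le ?_) le_rfl
        nlinarith [hv.1]
      · have := hv.2
        simp only [mem_Iio] at hu ⊢
        linarith
    calc _ ≤ eexp (-(δ * (x - u))) * (C * lqNorm r (Ioo (u + -1) (u + 0)) (G i)) :=
          mul_le_mul' le_rfl (hC i u)
      _ = C * (eexp (-(δ * (x - u))) * lqNorm r (Ioo (u + -1) (u + 0)) (G i)) := by ring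
      _ ≤ C * (eexp δ * R) := mul_le_mul' le_rfl h2
      _ = _ := by ring
  calc _ ≤ lqNorm q (Iio x) (fun u => eexp (-(δ * (x - u))) * (C * eexp δ * R)) := by
        refine lqNorm_mono measurableSet_Iio fun u hu => ?_
        refine le_trans (le_of_eq ?_) (mul_le_mul' le_rfl (h1 u hu))
        rw [← mul_assoc, ← eexp_add]
        ring_nf
    _ = K * (C * eexp δ * R) := by
        rw [lqNorm_mul_const hq, lqNorm_Iio_eexp]
        exact ENNReal.mul_ne_top (ENNReal.mul_ne_top ENNReal.coe_ne_top (eexp_ne_top _)) hR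
    _ ≤ _ := by
        rw [ENNReal.coe_add, ENNReal.coe_mul, ENNReal.coe_mul, coe_toNNReal_eexp,
          ENNReal.coe_toNNReal hK, add_mul]
        refine le_trans (le_of_eq ?_) le_self_add
        ring

/-- The weight decreases at least exponentially, up to a constant. -/
def Decay (w : ℝ → ℝ≥0∞) : Prop :=
  ∃ δ : ℝ, 0 < δ ∧ ∃ C : ℝ≥0, ∀ x u, u ≤ x → w x ≤ C * eexp (-(δ * (x - u))) * w u

/-- Half of the exponential decay pays for the growth of c. -/
theorem Slow.decay {c : ℝ → ℝ≥0∞} (hc : Slow c) {θ : ℝ} (hθ : 0 < θ) :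
    Decay fun x => eexp (-(θ * x)) * c x := by
  obtain ⟨C, hC⟩ := hc (θ / 2) (by positivity)
  refine ⟨θ / 2, by positivity, C, fun x u hu => ?_⟩
  refine (mul_le_mul' le_rfl (hC x u)).trans_eq ?_
  rw [abs_of_nonneg (sub_nonneg.2 hu)]
  have : eexp (-(θ * x)) * eexp (θ / 2 * (x - u)) =
      eexp (-(θ / 2 * (x - u))) * eexp (-(θ * u)) := by
    rw [← eexp_add, ← eexp_add]
    ring_nf
  calc _ = C * (eexp (-(θ * x)) * eexp (θ / 2 * (x - u))) * c u := by ring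
    _ = _ := by rw [this]; ring

/-- Hardy's inequality for functions of exponential growth. -/
theorem Grow.hardy {q r : ℝ≥0∞} (hq : 0 < q) (hr : 0 < r) {w : ℝ → ℝ≥0∞} (hw : Decay w)
    (hwF : Grow fun i x => w x * F i x) :
    (fun i (_ : ℝ) => lqNorm r univ fun x => w x * leftNorm q F i x) ≲
      fun i _ => lqNorm r univ fun x => w x * F i x := by
  obtain ⟨δ, hδ, C, hC⟩ := hw
  set K := lqNorm r (Iio 0) fun u => eexp (δ / 2 * u)
  have hK : K ≠ ∞ := lqNorm_eexp_ne_top hr (by positivity)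
  -- The decay rate is δ / 2 because passing from exponent q to exponent r costs half of δ. In
  -- Schur's test, 1 bounds the kernel pointwise and K is its r-norm in x.
  let k : ℝ → ℝ → ℝ≥0∞ := fun x u => (Ioi u).indicator (fun x => eexp (-(δ / 2 * (x - u)))) x
  have hk : Measurable (Function.uncurry k) := by
    have : Function.uncurry k =
        {z : ℝ × ℝ | z.2 < z.1}.indicator (fun z => eexp (-(δ / 2 * (z.1 - z.2)))) := by
      ext ⟨x, u⟩
      simp only [Function.uncurry, k, indicator, mem_Ioi, mem_ofPred_eq]
    rw [this]
    refine Measurable.indicator ?_ (measurableSet_lt measurable_snd measurable_fst)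
    exact measurable_eexp.comp (by fun_prop)
  refine hwF.dominated_of_kernel hr (M := 1 + K) hk (by simp [hK]) (fun x u => ?_) (fun u => ?_) ?_
  · refine le_trans ?_ (le_add_right le_rfl)
    by_cases h : u < x
    · simp only [k, indicator, mem_Ioi, h, if_true]
      rw [← eexp_zero]
      refine eexp_le ?_
      have := mul_pos (half_pos hδ) (sub_pos.2 h)
      linarith
    · simp [k, h]
  · refine le_trans (le_of_eq ?_) (le_add_left le_rfl)
    rw [lqNorm, Measure.restrict_univ, eLpNorm_indicator_eq_eLpNorm_restrict measurableSet_Ioi]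
    exact lqNorm_Ioi_eexp r (δ / 2) u
  · have h1 : (fun i x => w x * leftNorm q F i x) ≲ fun i x =>
        lqNorm q (Iio x) fun u => eexp (-(2 * (δ / 2) * (x - u))) * (w u * F i u) := by
      refine ⟨C, fun i x => (mul_lqNorm_le hq _ _ _).trans ?_⟩
      refine lqNorm_le_mul hq measurableSet_Iio ENNReal.coe_ne_top fun u hu => ?_
      refine (mul_le_mul' (hC x u (le_of_lt hu)) le_rfl).trans_eq ?_
      rw [mul_div_cancel₀ δ two_ne_zero]
      ring
    refine (h1.trans (hwF.leftNorm_eexp_dominated hq hr (half_pos hδ))).trans (.of_le fun i x => ?_)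
    refine le_trans (lqNorm_mono measurableSet_Iio fun u hu => ?_)
      (lqNorm_mono_set (subset_univ (Iio x)) _)
    have : u < x := hu
    simp [k, this]

end Families

/-! ### The truncated norms -/

/-- The function `x ↦ ‖β‖_{r,(x,∞)}`. -/
def tailNorm (r : ℝ≥0∞) (β : ℝ → ℝ≥0∞) (x : ℝ) : ℝ≥0∞ := lqNorm r (Ioi x) β

/-- The norm of the function `1` on `(x, ∞)`. -/
def tailIterNorm (r : ℝ≥0∞) (β : ℝ → ℝ≥0∞) (q : ℝ≥0∞) (α : ℝ → ℝ≥0∞) (x : ℝ) : ℝ≥0∞ :=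
  lqNorm r (Ioi x) fun s => β s * lqNorm q (Ioo x s) α

/-- The iterated norm which defines the space `𝓛`. -/
def iterNorm (r : ℝ≥0∞) (β : ℝ → ℝ≥0∞) (q : ℝ≥0∞) (α : ℝ → ℝ≥0∞) (k : ℝ → ℝ≥0∞) : ℝ≥0∞ :=
  lqNorm r univ fun s => β s * lqNorm q (Iio s) fun u => α u * k u

/-- Up to a constant, the iterated norm of the truncation `k (min x ·)`. -/
def truncNorm (r : ℝ≥0∞) (β : ℝ → ℝ≥0∞) (q : ℝ≥0∞) (α : ℝ → ℝ≥0∞) (k : ℝ → ℝ≥0∞) (x : ℝ) :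
    ℝ≥0∞ :=
  lqNorm r (Iio x) (fun s => β s * lqNorm q (Iio s) fun u => α u * k u) +
    tailNorm r β x * lqNorm q (Iio x) (fun u => α u * k u) + tailIterNorm r β q α x * k x

section Truncation

variable {ι : Type*} {r q : ℝ≥0∞} {α β : ℝ → ℝ≥0∞}

theorem lqNorm_Ioi_shift (q : ℝ≥0∞) (F : ℝ → ℝ≥0∞) (x y : ℝ) :
    lqNorm q (Ioi x) F = lqNorm q (Ioi y) fun u => F (u + (x - y)) := by
  rw [← lqNorm_comp_add q (Ioi x) F (x - y)]
  congr 1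
  ext u
  simp only [mem_preimage, mem_Ioi]
  constructor <;> intro <;> linarith

theorem lqNorm_Ioo_shift (q : ℝ≥0∞) (F : ℝ → ℝ≥0∞) (x y c : ℝ) :
    lqNorm q (Ioo (x + c) (y + c)) F = lqNorm q (Ioo x y) fun u => F (u + c) := by
  rw [← lqNorm_comp_add q (Ioo (x + c) (y + c)) F c]
  simp

theorem Slow.slow_tailNorm (hr : 0 < r) (hβ : Slow β) : Slow (tailNorm r β) := by
  intro ε hε
  obtain ⟨C, hC⟩ := hβ ε hε
  refine ⟨C, fun x y => ?_⟩
  unfold tailNorm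
  rw [lqNorm_Ioi_shift r β x y]
  refine lqNorm_le_mul hr measurableSet_Ioi
    (ENNReal.mul_ne_top ENNReal.coe_ne_top (eexp_ne_top _)) fun u _ => ?_
  simpa using hC (u + (x - y)) u

theorem Slow.slow_tailIterNorm (hr : 0 < r) (hq : 0 < q) (hβ : Slow β) (hα : Slow α) :
    Slow (tailIterNorm r β q α) := by
  intro ε hε
  obtain ⟨C, hC⟩ := hβ (ε / 2) (by positivity)
  obtain ⟨D, hD⟩ := hα (ε / 2) (by positivity)
  refine ⟨C * D, fun x y => ?_⟩
  unfold tailIterNorm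
  rw [lqNorm_Ioi_shift r _ x y]
  refine lqNorm_le_mul hr measurableSet_Ioi
    (ENNReal.mul_ne_top ENNReal.coe_ne_top (eexp_ne_top _)) fun s _ => ?_
  have h1 : lqNorm q (Ioo x (s + (x - y))) α ≤
      D * eexp (ε / 2 * |x - y|) * lqNorm q (Ioo y s) α := by
    have : x = y + (x - y) := by ring
    nth_rw 1 [this]
    rw [lqNorm_Ioo_shift]
    refine lqNorm_le_mul hq measurableSet_Ioo
      (ENNReal.mul_ne_top ENNReal.coe_ne_top (eexp_ne_top _)) fun u _ => ?_
    simpa using hD (u + (x - y)) u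
  have h2 : β (s + (x - y)) ≤ C * eexp (ε / 2 * |x - y|) * β s := by
    simpa using hC (s + (x - y)) s
  have := mul_le_growth h2 h1
  rwa [add_halves] at this

theorem mul_lqNorm_le_tailIterNorm (hr : 0 < r) (x : ℝ) :
    lqNorm r (Ioi (x + 1)) β * lqNorm q (Ioo (x + 0) (x + 1)) α ≤ tailIterNorm r β q α x := by
  rw [mul_comm, add_zero]
  refine (mul_lqNorm_le hr _ _ _).trans ((lqNorm_mono measurableSet_Ioi fun s hs => ?_).trans
    (lqNorm_mono_set (Ioi_subset_Ioi (by linarith)) _))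
  rw [mul_comm]
  refine mul_le_mul' le_rfl (lqNorm_mono_set (Ioo_subset_Ioo_right (le_of_lt hs)) _)

/-- It suffices to keep s in (x + 1, x + 2) and the inner variable in (x, x + 1), where β and α are
comparable to their values at x. -/
theorem Slow.mul_dominated_tailIterNorm (hr : 0 < r) (hq : 0 < q) (hβ : Slow β) (hα : Slow α) :
    (fun (_ : ι) x => β x * α x) ≲ fun _ x => tailIterNorm r β q α x := by
  refine (((Grow.of_slow hβ).dominated_lqNorm_Ioo hr (a := 1) (b := 2) (by norm_num)).mul
    ((Grow.of_slow hα).dominated_lqNorm_Ioo hq zero_lt_one)).trans (.of_le fun i x => ?_)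
  refine le_trans (mul_le_mul' (lqNorm_mono_set ?_ _) le_rfl) (mul_lqNorm_le_tailIterNorm hr x)
  exact Ioo_subset_Ioi_self

/-- By slow variation the tail may start at x + 1, which leaves (x, x + 1) inside every inner
interval. -/
theorem Slow.tailNorm_mul_dominated (hr : 0 < r) (hq : 0 < q) (hβ : Slow β) (hα : Slow α) :
    (fun (_ : ι) x => tailNorm r β x * α x) ≲ fun _ x => tailIterNorm r β q α x := by
  have h : (fun (_ : ι) x => tailNorm r β x) ≲ fun _ x => tailNorm r β (x + 1) := by
    obtain ⟨C, hC⟩ := hβ.slow_tailNorm hr 1 one_pos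
    refine ⟨C * (eexp 1).toNNReal, fun _ x => (hC x (x + 1)).trans_eq ?_⟩
    simp [coe_toNNReal_eexp]
  exact (h.mul ((Grow.of_slow hα).dominated_lqNorm_Ioo hq zero_lt_one)).trans
    (.of_le fun i x => mul_lqNorm_le_tailIterNorm hr x)

theorem Slow.tailNorm_ne_zero (hr : 0 < r) (hβ : Slow β) (hβ0 : ∀ x, β x ≠ 0) (x : ℝ) :
    tailNorm r β x ≠ 0 := by
  obtain ⟨C, hC⟩ := (Grow.of_slow (ι := Unit) hβ).dominated_lqNorm_Ioo hr zero_lt_one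
  intro h
  have h1 : lqNorm r (Ioo (x + 0) (x + 1)) β ≤ 0 := by
    rw [← h, add_zero]
    exact lqNorm_mono_set Ioo_subset_Ioi_self _
  refine hβ0 x (le_antisymm ((hC () x).trans ?_) zero_le)
  simp only [nonpos_iff_eq_zero.1 h1, mul_zero, le_refl]

theorem Slow.tailIterNorm_ne_zero (hr : 0 < r) (hq : 0 < q) (hβ : Slow β) (hα : Slow α)
    (hβ0 : ∀ x, β x ≠ 0) (hα0 : ∀ x, α x ≠ 0) (x : ℝ) : tailIterNorm r β q α x ≠ 0 := by
  obtain ⟨C, hC⟩ := hβ.mul_dominated_tailIterNorm (ι := Unit) hr hq hα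
  intro h
  have : β x * α x ≤ C * tailIterNorm r β q α x := hC () x
  rw [h, mul_zero, nonpos_iff_eq_zero] at this
  exact mul_ne_zero (hβ0 x) (hα0 x) this

theorem Slow.ne_top {w : ℝ → ℝ≥0∞} (hw : Slow w) {x₀ : ℝ} (h : w x₀ ≠ ∞) (x : ℝ) : w x ≠ ∞ := by
  obtain ⟨C, hC⟩ := hw 1 one_pos
  exact ne_top_of_le_ne_top (ENNReal.mul_ne_top (ENNReal.mul_ne_top ENNReal.coe_ne_top
    (eexp_ne_top _)) h) (hC x x₀)

/-- Guarantees that `toReal` loses nothing in the weights B₀ and B₁. -/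
theorem Slow.tailNorm_ne_top (hr : 0 < r) (hq : 0 < q) (hβ : Slow β) (hα : Slow α)
    (hα0 : ∀ x, α x ≠ 0) {x : ℝ} (h : tailIterNorm r β q α x ≠ ∞) :
    tailNorm r β x ≠ ∞ := by
  obtain ⟨C, hC⟩ := hβ.tailNorm_mul_dominated (ι := Unit) hr hq hα
  intro h'
  have : tailNorm r β x * α x ≤ C * tailIterNorm r β q α x := hC () x
  rw [h', ENNReal.top_mul (hα0 x), top_le_iff] at this
  exact ENNReal.mul_ne_top ENNReal.coe_ne_top h this

section TruncNorm

variable {κ κ₁ κ₂ : ι → ℝ → ℝ≥0∞}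

theorem Grow.lqNorm_mul (hq : 0 < q) (hα : Slow α) (hκ : Grow κ) :
    Grow fun i x => lqNorm q (Iio x) fun u => α u * κ i u :=
  ((Grow.of_slow hα).mul hκ).comp_leftNorm hq

theorem Grow.lqNorm_lqNorm_mul (hr : 0 < r) (hq : 0 < q) (hβ : Slow β) (hα : Slow α)
    (hκ : Grow κ) :
    Grow fun i x => lqNorm r (Iio x) fun s => β s * lqNorm q (Iio s) fun u => α u * κ i u :=
  (hκ.lqNorm_mul hq hα).lqNorm_mul hr hβ

theorem Grow.grow_truncNorm (hr : 0 < r) (hq : 0 < q) (hβ : Slow β) (hα : Slow α) (hκ : Grow κ) :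
    Grow fun i x => truncNorm r β q α (κ i) x :=
  ((hκ.lqNorm_lqNorm_mul hr hq hβ hα).add
    ((Grow.of_slow (hβ.slow_tailNorm hr)).mul (hκ.lqNorm_mul hq hα))).add
    ((Grow.of_slow (hβ.slow_tailIterNorm hr hq hα)).mul hκ)

theorem dominated_lqNorm_mul_add (hq : 0 < q) (hα : Slow α) (hκ₁ : Grow κ₁) (hκ₂ : Grow κ₂)
    (h : κ ≲ fun i x => κ₁ i x + κ₂ i x) :
    (fun i x => lqNorm q (Iio x) fun u => α u * κ i u) ≲ fun i x =>
      (lqNorm q (Iio x) fun u => α u * κ₁ i u) + lqNorm q (Iio x) fun u => α u * κ₂ i u := by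
  refine Dominated.trans ?_ (((Grow.of_slow hα).mul hκ₁).lqNorm_add hq (fun _ => measurableSet_Iio)
    ((Grow.of_slow hα).mul hκ₂))
  refine Dominated.comp_lqNorm hq (fun _ => measurableSet_Iio) ?_
  simpa only [mul_add] using h.mul_left α

theorem truncNorm_dominated_add (hr : 0 < r) (hq : 0 < q) (hβ : Slow β) (hα : Slow α)
    (hκ₁ : Grow κ₁) (hκ₂ : Grow κ₂) (h : κ ≲ fun i x => κ₁ i x + κ₂ i x) :
    (fun i x => truncNorm r β q α (κ i) x) ≲
      fun i x => truncNorm r β q α (κ₁ i) x + truncNorm r β q α (κ₂ i) x := by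
  have h1 := dominated_lqNorm_mul_add hq hα hκ₁ hκ₂ h
  have h2 := dominated_lqNorm_mul_add hr hβ (hκ₁.lqNorm_mul hq hα) (hκ₂.lqNorm_mul hq hα) h1
  refine ((h2.add (h1.mul_left (tailNorm r β))).add (h.mul_left (tailIterNorm r β q α))).trans
    (.of_le fun i x => le_of_eq ?_)
  unfold truncNorm
  ring

/-- Each of the three terms is at most the full norm: the first restricts the outer norm to s < x,
the other two to s > x, with the inner norm restricted to (-∞, x) or to (x, s); on (x, s)
monotonicity gives k ≥ k x. -/
theorem truncNorm_le_iterNorm (hr : 0 < r) (hq : 0 < q) {k : ℝ → ℝ≥0∞} (hk : Monotone k) (x : ℝ) :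
    truncNorm r β q α k x ≤ 3 * iterNorm r β q α k := by
  have h1 : lqNorm r (Iio x) (fun s => β s * lqNorm q (Iio s) fun u => α u * k u) ≤
      iterNorm r β q α k := lqNorm_mono_set (subset_univ _) _
  have h2 : tailNorm r β x * lqNorm q (Iio x) (fun u => α u * k u) ≤ iterNorm r β q α k := by
    rw [mul_comm]
    refine (mul_lqNorm_le hr _ _ _).trans ((lqNorm_mono measurableSet_Ioi fun s hs => ?_).trans
      (lqNorm_mono_set (subset_univ _) _))
    rw [mul_comm]
    exact mul_le_mul' le_rfl (lqNorm_mono_set (Iio_subset_Iio (le_of_lt hs)) _)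
  have h3 : tailIterNorm r β q α x * k x ≤ iterNorm r β q α k := by
    rw [mul_comm]
    refine (mul_lqNorm_le hr _ _ _).trans ((lqNorm_mono measurableSet_Ioi fun s hs => ?_).trans
      (lqNorm_mono_set (subset_univ _) _))
    rw [mul_left_comm]
    refine mul_le_mul' le_rfl ((mul_lqNorm_le hq _ _ _).trans
      ((lqNorm_mono measurableSet_Ioo fun u hu => ?_).trans
        (lqNorm_mono_set Ioo_subset_Iio_self _)))
    rw [mul_comm]
    exact mul_le_mul' le_rfl (hk hu.1.le)
  calc truncNorm r β q α k x ≤ iterNorm r β q α k + iterNorm r β q α k + iterNorm r β q α k :=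
        add_le_add (add_le_add h1 h2) h3
    _ = _ := by ring

/-- The iterated norm of a truncation. -/
theorem exists_iterNorm_le_truncNorm (hr : 0 < r) (hq : 0 < q) (hβ : Slow β) (hβ0 : ∀ x, β x ≠ 0)
    (D : ℝ≥0) :
    ∃ C : ℝ≥0, ∀ (k k' : ℝ → ℝ≥0∞) (x : ℝ), k x ≠ ∞ → (∀ y, k' y ≤ D * k (min y x)) →
      iterNorm r β q α k' ≤ C * truncNorm r β q α k x := by
  obtain ⟨Cq, hCq⟩ := exists_lqNorm_union_le hq
  obtain ⟨Cr, hCr⟩ := exists_lqNorm_union_le hr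
  obtain ⟨Ca, hCa⟩ := exists_lqNorm_add_le r
  obtain ⟨β', hβ', hββ', E, hE⟩ := (Grow.of_slow (ι := Unit) hβ).exists_measurable
  refine ⟨D * Cr + D * Cr * Cq * Ca * E + 1, fun k k' x hkx hk' => ?_⟩
  set L := lqNorm q (Iio x) fun u => α u * k u
  -- If L = ∞, the middle term of the truncated norm is infinite because the tail of β is nonzero.
  -- Otherwise L can be taken out of the outer norm.
  by_cases hL : L = ∞
  · refine le_top.trans_eq (Eq.symm ?_)
    have : truncNorm r β q α k x = ∞ := by
      have h0 : tailNorm r β x * L = ∞ := by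
        rw [hL, ENNReal.mul_top (hβ.tailNorm_ne_zero hr hβ0 x)]
      rw [truncNorm, h0]
      simp
    rw [this, ENNReal.mul_top (by simp)]
  have hD : (D : ℝ≥0∞) ≠ ∞ := ENNReal.coe_ne_top
  have h1 : ∀ s ∈ Iio x, β s * lqNorm q (Iio s) (fun u => α u * k' u) ≤
      D * (β s * lqNorm q (Iio s) fun u => α u * k u) := by
    intro s hs
    rw [mul_left_comm]
    refine mul_le_mul' le_rfl (lqNorm_le_mul hq measurableSet_Iio hD fun u hu => ?_)
    rw [mul_left_comm]
    refine mul_le_mul' le_rfl ((hk' u).trans_eq ?_)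
    rw [min_eq_left (le_of_lt (lt_trans hu hs))]
  -- For s > x the inner interval is split at x: below x it contributes at most D L, above x the
  -- function is at most D k(x). The measurable majorant β' allows the two pieces to be separated in
  -- the outer norm.
  have h2 : ∀ s ∈ Ioi x, β s * lqNorm q (Iio s) (fun u => α u * k' u) ≤
      (D * Cq : ℝ≥0) * (β' () s * L + β' () s * (lqNorm q (Ioo x s) α * k x)) := by
    intro s hs
    have hsub : Iio s = Iio x ∪ Ico x s := (Iio_union_Ico_eq_Iio (le_of_lt hs)).symm
    have h3 : lqNorm q (Iio x) (fun u => α u * k' u) ≤ D * L := by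
      refine lqNorm_le_mul hq measurableSet_Iio hD fun u hu => ?_
      rw [mul_left_comm]
      refine mul_le_mul' le_rfl ((hk' u).trans_eq ?_)
      rw [min_eq_left (le_of_lt hu)]
    have h4 : lqNorm q (Ico x s) (fun u => α u * k' u) ≤ D * (lqNorm q (Ioo x s) α * k x) := by
      have : lqNorm q (Ico x s) (fun u => α u * k' u) = lqNorm q (Ioo x s) fun u => α u * k' u := by
        rw [lqNorm, lqNorm, Measure.restrict_congr_set Ioo_ae_eq_Ico]
      rw [this, ← lqNorm_mul_const hq _ hkx]
      refine lqNorm_le_mul hq measurableSet_Ioo hD fun u hu => ?_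
      rw [mul_left_comm]
      refine mul_le_mul' le_rfl ((hk' u).trans_eq ?_)
      rw [min_eq_right hu.1.le]
    calc _ ≤ β' () s * (Cq * (D * L + D * (lqNorm q (Ioo x s) α * k x))) := by
          refine mul_le_mul' (hββ' () s) ?_
          rw [hsub]
          exact (hCq _ _ _).trans (mul_le_mul' le_rfl (add_le_add h3 h4))
      _ = _ := by
          rw [ENNReal.coe_mul]
          ring
  have hmono : Monotone fun s => lqNorm q (Ioo x s) α := fun s t hst =>
    lqNorm_mono_set (Ioo_subset_Ioo_right hst) _
  have h5 : lqNorm r (Ioi x) (fun s => β s * lqNorm q (Iio s) fun u => α u * k' u) ≤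
      (D * Cq : ℝ≥0) * (Ca * (E * (tailNorm r β x * L + tailIterNorm r β q α x * k x))) := by
    refine (lqNorm_le_mul hr measurableSet_Ioi ENNReal.coe_ne_top h2).trans
      (mul_le_mul' le_rfl ((hCa _ _ _ ((hβ' ()).mul_const _) ((hβ' ()).mul
        (hmono.measurable.mul_const _))).trans (mul_le_mul' le_rfl ?_)))
    rw [mul_add]
    refine add_le_add ?_ ?_
    · rw [tailNorm, ← lqNorm_mul_const hr _ hL]
      refine lqNorm_le_mul hr measurableSet_Ioi ENNReal.coe_ne_top fun s _ => ?_
      rw [← mul_assoc]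
      exact mul_le_mul' (hE () s) le_rfl
    · rw [tailIterNorm, ← lqNorm_mul_const hr _ hkx]
      refine lqNorm_le_mul hr measurableSet_Ioi ENNReal.coe_ne_top fun s _ => ?_
      refine (mul_le_mul' (hE () s) le_rfl).trans_eq ?_
      simp only [mul_assoc]
  have h6 : iterNorm r β q α k' ≤ Cr *
      (lqNorm r (Iio x) (fun s => β s * lqNorm q (Iio s) fun u => α u * k' u) +
        lqNorm r (Ioi x) (fun s => β s * lqNorm q (Iio s) fun u => α u * k' u)) := by
    refine le_trans (le_of_eq ?_) (hCr _ _ _)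
    rw [iterNorm, lqNorm, lqNorm, Iio_union_Ioi, restrict_compl_singleton, Measure.restrict_univ]
  set T := truncNorm r β q α k x
  have hT1 : lqNorm r (Iio x) (fun s => β s * lqNorm q (Iio s) fun u => α u * k u) ≤ T :=
    le_trans le_self_add le_self_add
  have hT2 : tailNorm r β x * L + tailIterNorm r β q α x * k x ≤ T := by
    refine le_trans le_add_self (le_of_eq (add_assoc _ _ _).symm)
  calc _ ≤ (Cr : ℝ≥0∞) * (D * T + (D * Cq : ℝ≥0) * (Ca * (E * T))) := by
        refine h6.trans (mul_le_mul' le_rfl (add_le_add ?_ ?_))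
        · exact (lqNorm_le_mul hr measurableSet_Iio hD h1).trans (mul_le_mul' le_rfl hT1)
        · exact h5.trans (mul_le_mul' le_rfl (mul_le_mul' le_rfl (mul_le_mul' le_rfl hT2)))
    _ = (D * Cr + D * Cr * Cq * Ca * E : ℝ≥0) * T := by
        push_cast
        ring
    _ ≤ _ := by
        refine mul_le_mul' ?_ le_rfl
        rw [ENNReal.coe_add _ 1]
        exact le_self_add

/-- Hardy's inequality for the truncated norms. -/
theorem Grow.truncNorm_hardy (hr : 0 < r) (hq : 0 < q) (hβ : Slow β) (hα : Slow α) (hκ : Grow κ)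
    {p : ℝ≥0∞} (hp : 0 < p) {c : ℝ → ℝ≥0∞} (hc : Slow c) {θ : ℝ} (hθ : 0 < θ) :
    (fun i (_ : ℝ) => lqNorm p univ fun x =>
        eexp (-(θ * x)) * c x * truncNorm r β q α (κ i) x) ≲
      fun i _ => lqNorm p univ fun x =>
        eexp (-(θ * x)) * c x * (tailIterNorm r β q α x * κ i x) := by
  have he : Grow fun (_ : ι) x => eexp (-(θ * x)) := by simpa using grow_eexp (ι := ι) (-θ)
  have hw : ∀ {v}, Slow v → Grow fun (_ : ι) x => eexp (-(θ * x)) * v x :=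
    fun hv => he.mul (.of_slow hv)
  have hακ : Grow fun i x => α x * κ i x := (Grow.of_slow hα).mul hκ
  have hJ := hκ.lqNorm_mul hq hα
  have hI := hκ.lqNorm_lqNorm_mul hr hq hβ hα
  have ht := Grow.of_slow (ι := ι) (hβ.slow_tailNorm hr)
  have hχ := Grow.of_slow (ι := ι) (hβ.slow_tailIterNorm hr hq hα)
  have hS : ∀ _ : ℝ, MeasurableSet (univ : Set ℝ) := fun _ => .univ
  set N : ι → ℝ → ℝ≥0∞ := fun i _ => lqNorm p univ fun x =>
    eexp (-(θ * x)) * c x * (tailIterNorm r β q α x * κ i x)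
  -- Hardy's inequality is used twice, removing the outer norm and then the inner one; what is left
  -- is β α ≲ χ.
  have h1 : (fun i (_ : ℝ) => lqNorm p univ fun x => eexp (-(θ * x)) * c x *
      lqNorm r (Iio x) fun s => β s * lqNorm q (Iio s) fun u => α u * κ i u) ≲ N := by
    refine (Grow.hardy hr hp (hc.decay hθ) ((hw hc).mul ((Grow.of_slow hβ).mul hJ))).trans ?_
    refine Dominated.trans (.of_le fun i _ => ?_) ((Grow.hardy hq hp ((hc.mul hβ).decay hθ)
      ((hw (hc.mul hβ)).mul hακ)).trans (Dominated.comp_lqNorm hp hS ?_))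
    · refine lqNorm_mono .univ fun x _ => le_of_eq ?_
      simp only [leftNorm]
      ring
    · refine Dominated.trans (.of_le fun i x => le_of_eq ?_) (((hβ.mul_dominated_tailIterNorm hr hq
        hα).mul (Dominated.refl κ)).mul_left fun x => eexp (-(θ * x)) * c x)
      ring
  -- The tail of β is slow, so it joins the weight and one use of Hardy's inequality suffices.
  have h2 : (fun i (_ : ℝ) => lqNorm p univ fun x => eexp (-(θ * x)) * c x *
      (tailNorm r β x * lqNorm q (Iio x) fun u => α u * κ i u)) ≲ N := by
    have hct := hc.mul (hβ.slow_tailNorm hr)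
    refine Dominated.trans (.of_le fun i _ => ?_) ((Grow.hardy hq hp (hct.decay hθ)
      ((hw hct).mul hακ)).trans (Dominated.comp_lqNorm hp hS ?_))
    · refine lqNorm_mono .univ fun x _ => le_of_eq ?_
      simp only [leftNorm]
      ring
    · refine Dominated.trans (.of_le fun i x => le_of_eq ?_) (((hβ.tailNorm_mul_dominated hr hq
        hα).mul (Dominated.refl κ)).mul_left fun x => eexp (-(θ * x)) * c x)
      ring
  refine Dominated.trans ?_ (Dominated.add_le (Dominated.add_le h1 h2) (.refl N))
  refine Dominated.trans ?_ ((Grow.lqNorm_add hp hS ((hw hc).mul hI)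
    ((hw hc).mul (ht.mul hJ))).add (.refl N))
  refine Dominated.trans (.of_le fun i _ => le_of_eq ?_) (Grow.lqNorm_add hp hS
    (((hw hc).mul hI).add ((hw hc).mul (ht.mul hJ))) ((hw hc).mul (hχ.mul hκ)))
  simp only [truncNorm, mul_add]

end TruncNorm

end Truncation

/-! ### Change of variables -/

/-- The difference of `p` and the identity is Lipschitz in the large, with any constant. -/
def AlmostTranslation (p : ℝ → ℝ) : Prop :=
  ∀ ε : ℝ, 0 < ε → ∃ c : ℝ, 0 ≤ c ∧ ∀ x y, |(p x - x) - (p y - y)| ≤ c + ε * |x - y|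

namespace AlmostTranslation

variable {p : ℝ → ℝ}

/-- The case ε = 1/2 of the definition: p is a quasi-isometry of ℝ. -/
theorem exists_abs_sub_le (hp : AlmostTranslation p) :
    ∃ c : ℝ, 0 ≤ c ∧ ∀ x y, |p x - p y| ≤ c + 3 / 2 * |x - y| ∧ |x - y| ≤ 2 * (c + |p x - p y|) := by
  obtain ⟨c, hc, h⟩ := hp (1 / 2) (by norm_num)
  refine ⟨c, hc, fun x y => ?_⟩
  have h1 := abs_sub_abs_le_abs_sub (p x - p y) (x - y)
  have h2 := abs_sub_abs_le_abs_sub (x - y) (p x - p y)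
  have h3 : |p x - p y - (x - y)| ≤ c + 1 / 2 * |x - y| := by
    convert h x y using 2
    ring
  rw [abs_sub_comm (x - y)] at h2
  constructor <;> linarith

theorem slow_comp (hp : AlmostTranslation p) {w : ℝ → ℝ≥0∞} (hw : Slow w) :
    Slow fun x => w (p x) := by
  intro ε hε
  obtain ⟨c, hc, h⟩ := hp.exists_abs_sub_le
  -- The factor 2/3 compensates the factor 3/2 by which p may stretch distances.
  obtain ⟨C, hC⟩ := hw (2 / 3 * ε) (by positivity)
  refine ⟨C * (eexp (2 / 3 * ε * c)).toNNReal, fun x y => (hC (p x) (p y)).trans ?_⟩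
  rw [ENNReal.coe_mul, coe_toNNReal_eexp, mul_assoc (C : ℝ≥0∞) (eexp _) (eexp _),
    ← eexp_add]
  refine mul_le_mul' (mul_le_mul' le_rfl (eexp_le ?_)) le_rfl
  nlinarith [(h x y).1]

theorem slow_eexp (hp : AlmostTranslation p) (t : ℝ) : Slow fun x => eexp (t * (p x - x)) := by
  intro ε hε
  have ht : 0 < |t| + 1 := by positivity
  obtain ⟨c, hc, h⟩ := hp (ε / (|t| + 1)) (by positivity)
  refine ⟨(eexp (|t| * c)).toNNReal, fun x y => ?_⟩
  rw [coe_toNNReal_eexp, ← eexp_add, ← eexp_add]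
  refine eexp_le ?_
  have h1 := le_abs_self (t * ((p x - x) - (p y - y)))
  rw [abs_mul] at h1
  have h2 := mul_le_mul_of_nonneg_left (h x y) (abs_nonneg t)
  have h3 : |t| * (ε / (|t| + 1)) ≤ ε := by
    rw [mul_div_assoc', div_le_iff₀ ht]
    nlinarith
  have h4 := mul_le_mul_of_nonneg_right h3 (abs_nonneg (x - y))
  linarith

theorem grow_comp {ι : Type*} (hp : AlmostTranslation p) {H : ι → ℝ → ℝ≥0∞} (hH : Grow H) :
    Grow fun i x => H i (p x) := by
  obtain ⟨c, hc, h⟩ := hp.exists_abs_sub_le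
  obtain ⟨M, hM, C, hC⟩ := hH
  refine ⟨3 / 2 * M, by positivity, C * (eexp (M * c)).toNNReal,
    fun i x y => (hC i (p x) (p y)).trans ?_⟩
  rw [ENNReal.coe_mul, coe_toNNReal_eexp, mul_assoc (C : ℝ≥0∞) (eexp _) (eexp _),
    ← eexp_add]
  refine mul_le_mul' (mul_le_mul' le_rfl (eexp_le ?_)) le_rfl
  nlinarith [(h x y).1]

/-- A substitute for surjectivity without continuity of p: for the largest integer n with p n ≤ s,
the next value exceeds s, and a unit step moves p by at most c + 3/2. -/
theorem exists_int_near (hp : AlmostTranslation p) :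
    ∃ d : ℝ, ∀ s, ∃ n : ℤ, |s - p n| ≤ d := by
  obtain ⟨c, hc, h⟩ := hp (1 / 2) (by norm_num)
  refine ⟨c + 3 / 2, fun s => ?_⟩
  have key : ∀ n m : ℤ, m ≤ n → |p n - p m - (n - m)| ≤ c + 1 / 2 * (n - m) := by
    intro n m hnm
    have h1 : ((m : ℝ)) ≤ n := by exact_mod_cast hnm
    have := h n m
    rw [abs_of_nonneg (sub_nonneg.2 h1)] at this
    convert this using 2
    ring
  have hbdd : ∀ z : ℤ, p z ≤ s → z ≤ max 0 ⌈2 * (s - p (0 : ℤ) + c)⌉ := by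
    intro z hz
    rcases le_total z 0 with h0 | h0
    · exact h0.trans (le_max_left _ _)
    · refine le_trans ?_ (le_max_right _ _)
      have h2 := abs_le.1 (key z 0 h0)
      have : (z : ℝ) ≤ 2 * (s - p (0 : ℤ) + c) := by
        push_cast at h2 ⊢
        linarith [h2.1]
      exact_mod_cast this.trans (Int.le_ceil _)
  have hinh : p ((min 0 ⌊2 * (s - p (0 : ℤ) - c)⌋ : ℤ) : ℝ) ≤ s := by
    set z : ℤ := min 0 ⌊2 * (s - p (0 : ℤ) - c)⌋
    have h2 := abs_le.1 (key 0 z (min_le_left _ _))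
    have h3 : (z : ℝ) ≤ 2 * (s - p (0 : ℤ) - c) :=
      (Int.cast_le.2 (min_le_right 0 _)).trans (Int.floor_le _)
    push_cast at h2 h3
    linarith [h2.2, h2.1]
  obtain ⟨n, hn, hn'⟩ := Int.exists_greatest_of_bdd (P := fun n : ℤ => p n ≤ s) ⟨_, hbdd⟩ ⟨_, hinh⟩
  refine ⟨n, ?_⟩
  have h1 : s < p ((n + 1 : ℤ) : ℝ) := by
    by_contra hcon
    have := hn' (n + 1) (not_lt.1 hcon)
    omega
  have h2 := abs_le.1 (key (n + 1) n (by omega))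
  push_cast at h1 h2
  rw [abs_of_nonneg (sub_nonneg.2 hn)]
  linarith [h2.2]

/-- No measurability of p is assumed; sampling p at the integers is measurable and, by
`exists_abs_floor_le`, changes its values by a bounded amount. -/
theorem measurable_comp_floor (p : ℝ → ℝ) : Measurable fun x : ℝ => p ((⌊x⌋ : ℤ) : ℝ) :=
  (measurable_from_top (f := fun n : ℤ => p n)).comp Int.measurable_floor

/-- The kernel which compares a function with its composition with `p`. -/
def kernel (p : ℝ → ℝ) (R x s : ℝ) : ℝ≥0∞ :=
  {z : ℝ × ℝ | |z.2 - p ((⌊z.1⌋ : ℤ) : ℝ)| ≤ R}.indicator (fun _ => 1) (x, s)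

theorem kernel_eq_one {R x s : ℝ} (h : |s - p ((⌊x⌋ : ℤ) : ℝ)| ≤ R) : kernel p R x s = 1 := by
  simp [kernel, h]

theorem kernel_le_one (R x s : ℝ) : kernel p R x s ≤ 1 := by
  unfold kernel
  exact indicator_le_self' (fun _ _ => zero_le) _

theorem measurable_kernel (p : ℝ → ℝ) (R : ℝ) :
    Measurable fun z : ℝ × ℝ => kernel p R z.1 z.2 := by
  refine Measurable.indicator measurable_const (measurableSet_le ?_ measurable_const)
  exact (measurable_snd.sub ((measurable_comp_floor p).comp measurable_fst)).abs

theorem lqNorm_Icc_one {r : ℝ≥0∞} (c D : ℝ) :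
    lqNorm r (Icc (c - D) (c + D)) (fun _ => 1) = lqNorm r (Icc (-D) D) fun _ => 1 := by
  rw [← lqNorm_comp_add r (Icc (c - D) (c + D)) _ c]
  congr 1
  ext u
  simp only [mem_preimage, mem_Icc]
  constructor <;> rintro ⟨h1, h2⟩ <;> constructor <;> linarith

/-- A function supported by an interval, and bounded by one. -/
theorem lqNorm_le_of_support {r : ℝ≥0∞} {F : ℝ → ℝ≥0∞} {D : ℝ} (hF : ∀ x, F x ≤ 1)
    (hs : ∀ x y, F x ≠ 0 → F y ≠ 0 → |x - y| ≤ D) :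
    lqNorm r univ F ≤ lqNorm r (Icc (-D) D) fun _ => 1 := by
  by_cases h : ∃ c, F c ≠ 0
  · obtain ⟨c, hc⟩ := h
    rw [← lqNorm_Icc_one c D]
    have h1 : F = (Icc (c - D) (c + D)).indicator F := by
      symm
      rw [indicator_eq_self]
      intro x hx
      have := abs_le.1 (hs x c hx hc)
      constructor <;> linarith [this.1, this.2]
    rw [lqNorm, Measure.restrict_univ, h1, eLpNorm_indicator_eq_eLpNorm_restrict measurableSet_Icc]
    exact lqNorm_mono measurableSet_Icc fun x _ => hF x
  · push Not at h
    have : F = 0 := funext h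
    simp [lqNorm, this]

theorem exists_abs_floor_le (hp : AlmostTranslation p) :
    ∃ d : ℝ, 0 ≤ d ∧ ∀ x : ℝ, |p x - p ((⌊x⌋ : ℤ) : ℝ)| ≤ d := by
  obtain ⟨c, hc, h⟩ := hp.exists_abs_sub_le
  refine ⟨c + 3 / 2, by positivity, fun x => (h x _).1.trans ?_⟩
  have : |x - ((⌊x⌋ : ℤ) : ℝ)| ≤ 1 := by
    rw [abs_of_nonneg (sub_nonneg.2 (Int.floor_le x))]
    linarith [Int.lt_floor_add_one x]
  linarith

/-- For fixed x the support in s is an interval of length 2R; for fixed s the support in x is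
bounded because p is a quasi-isometry. -/
theorem exists_lqNorm_kernel_le (hp : AlmostTranslation p) (r : ℝ≥0∞) (R : ℝ) :
    ∃ M : ℝ≥0∞, M ≠ ∞ ∧ 1 ≤ M ∧ (∀ s, lqNorm r univ (fun x => kernel p R x s) ≤ M) ∧
      ∀ x, lqNorm r univ (fun s => kernel p R x s) ≤ M := by
  obtain ⟨d, hd, hfl⟩ := hp.exists_abs_floor_le
  obtain ⟨c, hc, h⟩ := hp.exists_abs_sub_le
  have hne : ∀ {x s}, kernel p R x s ≠ 0 → |s - p ((⌊x⌋ : ℤ) : ℝ)| ≤ R := by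
    intro x s hxs
    by_contra hcon
    exact hxs (by simp [kernel, hcon])
  have h1 : ∀ {x s}, kernel p R x s ≠ 0 → |s - p x| ≤ R + d := by
    intro x s hxs
    have h2 := abs_sub_le s (p ((⌊x⌋ : ℤ) : ℝ)) (p x)
    have h3 := hfl x
    rw [abs_sub_comm] at h3
    linarith [hne hxs]
  set D := 2 * (c + 2 * (R + d))
  set E := 2 * R
  refine ⟨1 + (lqNorm r (Icc (-D) D) (fun _ => 1) + lqNorm r (Icc (-E) E) (fun _ => 1)), ?_,
    le_self_add, fun s => ?_, fun x => ?_⟩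
  · refine ENNReal.add_ne_top.2 ⟨ENNReal.one_ne_top, ENNReal.add_ne_top.2 ⟨?_, ?_⟩⟩ <;>
      exact lqNorm_one_ne_top (by simp)
  · refine (lqNorm_le_of_support (fun x => kernel_le_one R x s) fun x y hx hy => ?_).trans
      (le_self_add.trans le_add_self)
    refine (h x y).2.trans ?_
    have h2 := abs_sub_le (p x) s (p y)
    have h3 := h1 hx
    rw [abs_sub_comm] at h3
    have h4 := h1 hy
    simp only [D]
    linarith
  · refine (lqNorm_le_of_support (fun s => kernel_le_one R x s) fun s t hs ht => ?_).trans
      (le_add_self.trans le_add_self)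
    have h2 := abs_sub_le s (p ((⌊x⌋ : ℤ) : ℝ)) t
    have h3 := hne ht
    rw [abs_sub_comm] at h3
    simp only [E]
    linarith [hne hs]

/-- H (p x) is dominated by the norm of H over (p x - 1, p x + 1), where the kernel with radius d +
1 equals 1 (d accounts for the floor). Schur's test then replaces a change of variables, so p need
be neither injective nor differentiable. -/
theorem lqNorm_comp_dominated {ι : Type*} (hp : AlmostTranslation p) {r : ℝ≥0∞} (hr : 0 < r)
    {H : ι → ℝ → ℝ≥0∞} (hH : Grow H) :
    (fun i (_ : ℝ) => lqNorm r univ fun x => H i (p x)) ≲ fun i _ => lqNorm r univ (H i) := by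
  obtain ⟨d, hd, hfl⟩ := hp.exists_abs_floor_le
  obtain ⟨M, hM, hM1, hM2, -⟩ := hp.exists_lqNorm_kernel_le r (d + 1)
  refine hH.dominated_of_kernel hr (k := kernel p (d + 1)) (measurable_kernel p (d + 1)) hM
    (fun x u => (kernel_le_one _ _ _).trans hM1) hM2 ?_
  obtain ⟨C, hC⟩ := hH.dominated_lqNorm_Ioo hr (a := -1) (b := 1) (by norm_num)
  refine ⟨C, fun i x => (hC i (p x)).trans (mul_le_mul' le_rfl ?_)⟩
  refine le_trans (lqNorm_mono measurableSet_Ioo fun s hs => ?_) (lqNorm_mono_set (subset_univ _) _)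
  have h1 : |s - p x| ≤ 1 := abs_le.2 ⟨by linarith [hs.1], by linarith [hs.2]⟩
  have h2 := abs_sub_le s (p x) (p ((⌊x⌋ : ℤ) : ℝ))
  rw [kernel_eq_one (by linarith [hfl x]), one_mul]

/-- Schur's test with the transposed kernel: if p n is near s, then p x stays near s for x in (n, n
+ 1), so H s is dominated by the norm of H ∘ p there. -/
theorem lqNorm_dominated_comp {ι : Type*} (hp : AlmostTranslation p) {r : ℝ≥0∞} (hr : 0 < r)
    {H : ι → ℝ → ℝ≥0∞} (hH : Grow H) :
    (fun i (_ : ℝ) => lqNorm r univ (H i)) ≲ fun i _ => lqNorm r univ fun x => H i (p x) := by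
  obtain ⟨d, hd, hfl⟩ := hp.exists_abs_floor_le
  obtain ⟨R, hR⟩ := hp.exists_int_near
  obtain ⟨M, hM, hM1, -, hM2⟩ := hp.exists_lqNorm_kernel_le r R
  refine (hp.grow_comp hH).dominated_of_kernel hr (k := fun s x => kernel p R x s)
    ((measurable_kernel p R).comp measurable_swap) hM
    (fun x u => (kernel_le_one _ _ _).trans hM1) hM2 ?_
  obtain ⟨L, hL, C, hC⟩ := hH
  set c := lqNorm r (Ioo 0 1) fun _ => 1
  have hc0 : c ≠ 0 := lqNorm_one_ne_zero hr (by simp)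
  have hct : c ≠ ∞ := lqNorm_one_ne_top (by simp)
  set D := (C : ℝ≥0∞) * eexp (L * (R + d))
  have hD : D ≠ ∞ := ENNReal.mul_ne_top ENNReal.coe_ne_top (eexp_ne_top _)
  refine ⟨(c⁻¹ * D).toNNReal, fun i s => ?_⟩
  rw [ENNReal.coe_toNNReal (ENNReal.mul_ne_top (ENNReal.inv_ne_top.2 hc0) hD), mul_assoc]
  obtain ⟨n, hn⟩ := hR s
  have hx : c = lqNorm r (Ioo (n : ℝ) (n + 1)) fun _ => 1 := by
    rw [← lqNorm_comp_add r (Ioo (n : ℝ) (n + 1)) _ n]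
    simp [c]
  have h1 : H i s = c⁻¹ * (H i s * c) := by
    rw [mul_comm (H i s), ← mul_assoc, ENNReal.inv_mul_cancel hc0 hct, one_mul]
  rw [h1]
  refine mul_le_mul' le_rfl ?_
  rw [hx]
  refine (mul_lqNorm_le hr _ _ _).trans ((lqNorm_le_mul hr measurableSet_Ioo hD (G := fun x =>
    kernel p R x s * H i (p x)) fun x hx => ?_).trans
    (mul_le_mul' le_rfl (lqNorm_mono_set (subset_univ _) _)))
  have hfloor : ⌊x⌋ = n := Int.floor_eq_iff.2 ⟨hx.1.le, hx.2⟩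
  have h2 := hfl x
  rw [hfloor] at h2
  rw [kernel_eq_one (by rwa [hfloor]), mul_one, one_mul]
  refine (hC i s (p x)).trans (mul_le_mul' (mul_le_mul' le_rfl (eexp_le ?_)) le_rfl)
  refine mul_le_mul_of_nonneg_left ?_ hL
  have h3 := abs_sub_le s (p n) (p x)
  rw [abs_sub_comm] at h2
  linarith

end AlmostTranslation

/-- Applied to χ₀ and χ₁, this makes log ρ(e^x) an almost translation. -/
theorem Slow.exists_abs_log_sub_le {w : ℝ → ℝ≥0∞} (hw : Slow w) (h0 : ∀ x, w x ≠ 0)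
    (ht : ∀ x, w x ≠ ∞) {ε : ℝ} (hε : 0 < ε) :
    ∃ c : ℝ, 0 ≤ c ∧
      ∀ x y, |Real.log (w x).toReal - Real.log (w y).toReal| ≤ c + ε * |x - y| := by
  obtain ⟨C, hC⟩ := hw ε hε
  have hpos : ∀ x, 0 < (w x).toReal := fun x => ENNReal.toReal_pos (h0 x) (ht x)
  have key : ∀ x y, Real.log (w x).toReal - Real.log (w y).toReal ≤
      |Real.log C| + ε * |x - y| := by
    intro x y
    have h1 := ENNReal.toReal_mono (ENNReal.mul_ne_top (ENNReal.mul_ne_top ENNReal.coe_ne_top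
      (eexp_ne_top _)) (ht y)) (hC x y)
    rw [ENNReal.toReal_mul, ENNReal.toReal_mul, ENNReal.coe_toReal, eexp,
      ENNReal.toReal_ofReal (Real.exp_pos _).le] at h1
    have hCpos : (0 : ℝ) < C := by
      rcases eq_or_lt_of_le C.coe_nonneg with h | h
      · rw [← h, zero_mul, zero_mul] at h1
        exact absurd h1 (not_le.2 (hpos x))
      · exact h
    have h2 := Real.log_le_log (hpos x) h1
    rw [Real.log_mul (by positivity) (hpos y).ne', Real.log_mul hCpos.ne' (Real.exp_pos _).ne',
      Real.log_exp] at h2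
    linarith [le_abs_self (Real.log C)]
  refine ⟨|Real.log C|, abs_nonneg _, fun x y => abs_le.2 ⟨?_, key x y⟩⟩
  have := key y x
  rw [abs_sub_comm] at this
  linarith

/-! ### Quasi-concave functions in the logarithmic variable -/

/-- The function `t ↦ k (log t)` is quasi-concave. -/
structure LogQuasiConcave (k : ℝ → ℝ≥0∞) : Prop where
  monotone : Monotone k
  le_mul : ∀ u v, u ≤ v → k v ≤ eexp (v - u) * k u

/-- In the variable `t = e^x`, this is the passage from `k(t)` to `t k(1/t)`. -/
def reflect (k : ℝ → ℝ≥0∞) (x : ℝ) : ℝ≥0∞ := eexp x * k (-x)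

theorem reflect_reflect (k : ℝ → ℝ≥0∞) : reflect (reflect k) = k := by
  funext x
  rw [reflect, reflect, neg_neg, ← mul_assoc, eexp_mul_neg, one_mul]

/-- Reflection exchanges the two defining conditions. -/
theorem LogQuasiConcave.reflected {k : ℝ → ℝ≥0∞} (hk : LogQuasiConcave k) :
    LogQuasiConcave (reflect k) where
  monotone x y hxy := by
    unfold reflect
    refine (mul_le_mul' le_rfl (hk.le_mul (-y) (-x) (by linarith))).trans_eq ?_
    rw [← mul_assoc, ← eexp_add]
    ring_nf
  le_mul u v huv := by
    unfold reflect
    rw [← mul_assoc, ← eexp_add, sub_add_cancel]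
    exact mul_le_mul' le_rfl (hk.monotone (by linarith))

theorem LogQuasiConcave.grow {ι : Type*} {κ : ι → ℝ → ℝ≥0∞} (h : ∀ i, LogQuasiConcave (κ i)) :
    Grow κ := by
  refine ⟨1, zero_le_one, 1, fun i x y => ?_⟩
  rw [ENNReal.coe_one, one_mul, one_mul]
  rcases le_total x y with hxy | hxy
  · refine ((h i).monotone hxy).trans ?_
    exact le_mul_of_one_le_left' (one_le_eexp (abs_nonneg _))
  · rw [abs_of_nonneg (sub_nonneg.2 hxy)]
    exact (h i).le_mul y x hxy

theorem Slow.inv {w : ℝ → ℝ≥0∞} (hw : Slow w) (h0 : ∀ x, w x ≠ 0) (ht : ∀ x, w x ≠ ∞) :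
    Slow fun x => (w x)⁻¹ := by
  intro ε hε
  obtain ⟨C, hC⟩ := hw ε hε
  refine ⟨C, fun x y => ?_⟩
  have h1 : (w x)⁻¹ * w y * (w y)⁻¹ ≤ (w x)⁻¹ * (C * eexp (ε * |y - x|) * w x) * (w y)⁻¹ :=
    mul_le_mul' (mul_le_mul' le_rfl (hC y x)) le_rfl
  calc (w x)⁻¹ = (w x)⁻¹ * w y * (w y)⁻¹ := by
        rw [mul_assoc, ENNReal.mul_inv_cancel (h0 y) (ht y), mul_one]
    _ ≤ _ := h1
    _ = C * eexp (ε * |y - x|) * ((w x)⁻¹ * w x) * (w y)⁻¹ := by ring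
    _ = _ := by rw [ENNReal.inv_mul_cancel (h0 x) (ht x), mul_one, abs_sub_comm]

theorem truncNorm_le_mul {r q : ℝ≥0∞} (hr : 0 < r) (hq : 0 < q) (β α : ℝ → ℝ≥0∞)
    {k k' : ℝ → ℝ≥0∞} {c : ℝ≥0∞} (hc : c ≠ ∞) (h : ∀ u, k u ≤ c * k' u) (x : ℝ) :
    truncNorm r β q α k x ≤ c * truncNorm r β q α k' x := by
  have h1 : ∀ s, lqNorm q (Iio s) (fun u => α u * k u) ≤
      c * lqNorm q (Iio s) fun u => α u * k' u := by
    intro s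
    refine lqNorm_le_mul hq measurableSet_Iio hc fun u _ => ?_
    rw [mul_left_comm]
    exact mul_le_mul' le_rfl (h u)
  have h2 : lqNorm r (Iio x) (fun s => β s * lqNorm q (Iio s) fun u => α u * k u) ≤
      c * lqNorm r (Iio x) fun s => β s * lqNorm q (Iio s) fun u => α u * k' u := by
    refine lqNorm_le_mul hr measurableSet_Iio hc fun s _ => ?_
    rw [mul_left_comm]
    exact mul_le_mul' le_rfl (h1 s)
  unfold truncNorm
  refine (add_le_add (add_le_add h2 (mul_le_mul' le_rfl (h1 x)))
    (mul_le_mul' le_rfl (h x))).trans_eq ?_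
  ring

/-- The parameters of a space `𝓛`, in the logarithmic variable. -/
structure IterData where
  r : ℝ≥0∞
  β : ℝ → ℝ≥0∞
  q : ℝ≥0∞
  α : ℝ → ℝ≥0∞
  r_pos : 0 < r
  q_pos : 0 < q
  slow_β : Slow β
  slow_α : Slow α
  β_ne_zero : ∀ x, β x ≠ 0
  α_ne_zero : ∀ x, α x ≠ 0
  fin : ∃ x, tailIterNorm r β q α x ≠ ∞

/-! ### Estimates for a single space, and the duality between a space and its reflected partner -/

namespace IterData

variable (D : IterData)

/-- The norm of the space. -/
def norm (k : ℝ → ℝ≥0∞) : ℝ≥0∞ := iterNorm D.r D.β D.q D.α k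

/-- The norm of the truncation at a point. -/
def trunc (k : ℝ → ℝ≥0∞) (x : ℝ) : ℝ≥0∞ := truncNorm D.r D.β D.q D.α k x

/-- The norm of `1` beyond a point. -/
def chi (x : ℝ) : ℝ≥0∞ := tailIterNorm D.r D.β D.q D.α x

theorem slow_chi : Slow D.chi := D.slow_β.slow_tailIterNorm D.r_pos D.q_pos D.slow_α

theorem chi_ne_zero (x : ℝ) : D.chi x ≠ 0 :=
  D.slow_β.tailIterNorm_ne_zero D.r_pos D.q_pos D.slow_α D.β_ne_zero D.α_ne_zero x

theorem chi_ne_top (x : ℝ) : D.chi x ≠ ∞ :=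
  let ⟨_, h⟩ := D.fin
  D.slow_chi.ne_top h x

theorem trunc_le_norm {k : ℝ → ℝ≥0∞} (hk : Monotone k) (x : ℝ) : D.trunc k x ≤ 3 * D.norm k :=
  truncNorm_le_iterNorm D.r_pos D.q_pos hk x

theorem chi_mul_le_trunc (k : ℝ → ℝ≥0∞) (x : ℝ) : D.chi x * k x ≤ D.trunc k x := le_add_self

theorem grow_trunc {ι : Type*} {κ : ι → ℝ → ℝ≥0∞} (hκ : Grow κ) :
    Grow fun i x => D.trunc (κ i) x :=
  hκ.grow_truncNorm D.r_pos D.q_pos D.slow_β D.slow_α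

theorem hardy {ι : Type*} {κ : ι → ℝ → ℝ≥0∞} (hκ : Grow κ)
    {p : ℝ≥0∞} (hp : 0 < p) {c : ℝ → ℝ≥0∞} (hc : Slow c) {θ : ℝ} (hθ : 0 < θ) :
    (fun i (_ : ℝ) => lqNorm p univ fun x => eexp (-(θ * x)) * c x * D.trunc (κ i) x) ≲
      fun i _ => lqNorm p univ fun x => eexp (-(θ * x)) * c x * (D.chi x * κ i x) :=
  hκ.truncNorm_hardy D.r_pos D.q_pos D.slow_β D.slow_α hp hc hθ

/-- The truncated norm is controlled by the norm of the space with reflected data. -/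
theorem chi_mul_trunc_dominated (D E : IterData) {ι : Type*} {κ : ι → ℝ → ℝ≥0∞}
    (hκ : ∀ i, LogQuasiConcave (κ i)) :
    (fun i x => E.chi (-x) * D.trunc (κ i) x) ≲
      fun i x => eexp x * D.chi x * E.norm (reflect (κ i)) := by
  -- The extremal function: up to the factor 3 Y, it majorizes every κ whose reflection has norm Y
  -- in the space of E.
  set h : Unit → ℝ → ℝ≥0∞ := fun _ u => eexp u * (E.chi (-u))⁻¹
  have hg : Grow h := by
    have h1 : Grow fun (_ : Unit) u => eexp u := by simpa using grow_eexp (ι := Unit) 1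
    exact h1.mul (Grow.of_slow (E.slow_chi.inv E.chi_ne_zero E.chi_ne_top).comp_neg)
  have hc : Slow fun x => E.chi (-x) * (D.chi x)⁻¹ :=
    E.slow_chi.comp_neg.mul (D.slow_chi.inv D.chi_ne_zero D.chi_ne_top)
  have he : Grow fun (_ : Unit) x => eexp (-(1 * x)) := by simpa using grow_eexp (ι := Unit) (-1)
  have hb := ((he.mul (Grow.of_slow hc)).mul (D.grow_trunc hg)).dominated_lqNorm_univ
    ENNReal.zero_lt_top
  -- Hardy's inequality with exponent ∞ and a weight for which weight · χ · h is identically 1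
  -- (`hone`); it bounds the weighted truncated norm of h, and growth makes the bound hold at every
  -- point.
  obtain ⟨C, hC⟩ := hb.trans (D.hardy hg ENNReal.zero_lt_top hc one_pos)
  have hone : ∀ x, eexp (-(1 * x)) * (E.chi (-x) * (D.chi x)⁻¹) * (D.chi x * h () x) = 1 := by
    intro x
    calc _ = (eexp x * eexp (-(1 * x))) * (E.chi (-x) * (E.chi (-x))⁻¹) *
          (D.chi x * (D.chi x)⁻¹) := by simp only [h]; ring
      _ = 1 := by
        rw [one_mul, eexp_mul_neg, ENNReal.mul_inv_cancel (E.chi_ne_zero _) (E.chi_ne_top _),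
          ENNReal.mul_inv_cancel (D.chi_ne_zero _) (D.chi_ne_top _), one_mul, one_mul]
  have hC' : ∀ x, eexp (-(1 * x)) * (E.chi (-x) * (D.chi x)⁻¹) * D.trunc (h ()) x ≤ C := by
    intro x
    refine (hC () x).trans ?_
    refine (mul_le_mul' le_rfl (?_ : _ ≤ (1 : ℝ≥0∞))).trans_eq (mul_one _)
    refine (lqNorm_top _ _).trans_le ?_
    exact essSup_le_of_ae_le _ (Eventually.of_forall fun x => (hone x).le)
  refine ⟨3 * C + 1, fun i x => ?_⟩
  set Y := E.norm (reflect (κ i))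
  by_cases hY : Y = ∞
  · refine le_top.trans_eq (Eq.symm ?_)
    change _ * (_ * Y) = ∞
    rw [hY, ENNReal.mul_top (mul_ne_zero (eexp_ne_zero _) (D.chi_ne_zero _)),
      ENNReal.mul_top (by simp)]
  -- The last term of the truncated norm of the reflection at -u is at most 3 Y; solving for κ gives
  -- h.
  have h3 : ∀ u, κ i u ≤ 3 * Y * h () u := by
    intro u
    have h4 : E.chi (-u) * (eexp (-u) * κ i u) ≤ 3 * Y := by
      refine le_trans (le_of_eq ?_) ((E.chi_mul_le_trunc (reflect (κ i)) (-u)).trans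
        (E.trunc_le_norm (hκ i).reflected.monotone (-u)))
      rw [reflect, neg_neg]
    calc κ i u = (eexp u * eexp (-u)) * (E.chi (-u) * (E.chi (-u))⁻¹) * κ i u := by
          rw [eexp_mul_neg, ENNReal.mul_inv_cancel (E.chi_ne_zero _) (E.chi_ne_top _), one_mul,
            one_mul]
      _ = (E.chi (-u) * (eexp (-u) * κ i u)) * h () u := by simp only [h]; ring
      _ ≤ _ := mul_le_mul' h4 le_rfl
  have h5 : D.trunc (κ i) x ≤ 3 * Y * D.trunc (h ()) x :=
    truncNorm_le_mul D.r_pos D.q_pos _ _ (ENNReal.mul_ne_top (by simp) hY) h3 x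
  calc E.chi (-x) * D.trunc (κ i) x ≤ E.chi (-x) * (3 * Y * D.trunc (h ()) x) :=
        mul_le_mul' le_rfl h5
    _ = (eexp x * eexp (-(1 * x))) * (D.chi x * (D.chi x)⁻¹) *
          (E.chi (-x) * (3 * Y * D.trunc (h ()) x)) := by
        rw [one_mul, eexp_mul_neg, ENNReal.mul_inv_cancel (D.chi_ne_zero _) (D.chi_ne_top _),
          one_mul, one_mul]
    _ = 3 * (eexp x * D.chi x * Y) *
          (eexp (-(1 * x)) * (E.chi (-x) * (D.chi x)⁻¹) * D.trunc (h ()) x) := by ring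
    _ ≤ 3 * (eexp x * D.chi x * Y) * C := mul_le_mul' le_rfl (hC' x)
    _ = 3 * C * (eexp x * D.chi x * Y) := by ring
    _ ≤ _ := by
        refine mul_le_mul' ?_ le_rfl
        push_cast
        exact le_self_add

end IterData

/-! ### The `K`-functional -/

section KFunctional

variable {X : Type*} [AddCommGroup X]

theorem peetreK_le (A₀ A₁ : X → ℝ≥0∞) (t : ℝ) (f₀ f₁ : X) :
    peetreK A₀ A₁ t (f₀ + f₁) ≤ A₀ f₀ + ENNReal.ofReal t * A₁ f₁ :=
  iInf_le_of_le f₀ (iInf_le_of_le f₁ (iInf_le_of_le rfl le_rfl))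

theorem exists_lt_of_peetreK_lt {A₀ A₁ : X → ℝ≥0∞} {t : ℝ} {f : X} {c : ℝ≥0∞}
    (h : peetreK A₀ A₁ t f < c) :
    ∃ f₀ f₁, f = f₀ + f₁ ∧ A₀ f₀ + ENNReal.ofReal t * A₁ f₁ < c := by
  simp only [peetreK, iInf_lt_iff] at h
  obtain ⟨f₀, f₁, hf, h⟩ := h
  exact ⟨f₀, f₁, hf, h⟩

/-- The added 1 makes the constant nonzero, so that it can be divided out when passing to the
infimum. -/
theorem le_mul_peetreK {A₀ A₁ : X → ℝ≥0∞} {t : ℝ} {f : X} {a : ℝ≥0∞} {C : ℝ≥0}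
    (h : ∀ f₀ f₁, f = f₀ + f₁ → a ≤ C * (A₀ f₀ + ENNReal.ofReal t * A₁ f₁)) :
    a ≤ (C + 1 : ℝ≥0) * peetreK A₀ A₁ t f := by
  have hC : ((C + 1 : ℝ≥0) : ℝ≥0∞) ≠ 0 := by simp
  by_contra hcon
  rw [not_le, mul_comm, ← ENNReal.lt_div_iff_mul_lt (Or.inl hC) (Or.inl ENNReal.coe_ne_top)] at hcon
  obtain ⟨f₀, f₁, hf, h1⟩ := exists_lt_of_peetreK_lt hcon
  rw [ENNReal.lt_div_iff_mul_lt (Or.inl hC) (Or.inl ENNReal.coe_ne_top), mul_comm] at h1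
  refine absurd ((h f₀ f₁ hf).trans (mul_le_mul' ?_ le_rfl)) (not_le.2 h1)
  exact_mod_cast le_self_add

/-- The `K`-functional in the logarithmic variable. -/
def logK (A₀ A₁ : X → ℝ≥0∞) (f : X) (x : ℝ) : ℝ≥0∞ := peetreK A₀ A₁ (Real.exp x) f

theorem logK_le (A₀ A₁ : X → ℝ≥0∞) (f₀ f₁ : X) (x : ℝ) :
    logK A₀ A₁ (f₀ + f₁) x ≤ A₀ f₀ + eexp x * A₁ f₁ :=
  peetreK_le A₀ A₁ _ f₀ f₁

theorem logQuasiConcave_logK (A₀ A₁ : X → ℝ≥0∞) (f : X) : LogQuasiConcave (logK A₀ A₁ f) where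
  monotone x y hxy := by
    refine le_iInf fun f₀ => le_iInf fun f₁ => le_iInf fun hf => ?_
    rw [hf]
    exact (logK_le _ _ _ _ _).trans (add_le_add le_rfl (mul_le_mul' (eexp_le hxy) le_rfl))
  le_mul u v huv := by
    have h0 := eexp_ne_zero (v - u)
    have ht := eexp_ne_top (v - u)
    rw [← ENNReal.div_le_iff' h0 ht]
    refine le_iInf fun f₀ => le_iInf fun f₁ => le_iInf fun hf => ?_
    rw [ENNReal.div_le_iff' h0 ht, hf, mul_add]
    refine (logK_le _ _ _ _ _).trans (add_le_add ?_ (le_of_eq ?_))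
    · exact le_mul_of_one_le_left' (one_le_eexp (by linarith))
    · change _ = eexp (v - u) * (eexp u * _)
      rw [← mul_assoc, ← eexp_add, sub_add_cancel]

variable {𝕜 : Type*} [RCLike 𝕜] [Module 𝕜 X] [TopologicalSpace X] {A₀ A₁ : X → ℝ≥0∞}

theorem IsQuasiBanach.map_zero {N : X → ℝ≥0∞} (h : IsQuasiBanach 𝕜 N) : N 0 = 0 :=
  (h.eq_zero_iff 0).2 rfl

theorem IsQuasiBanach.map_neg {N : X → ℝ≥0∞} (h : IsQuasiBanach 𝕜 N) (x : X) : N (-x) = N x := by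
  have := h.smul (-1) x
  simpa using this

namespace IsCompatibleCouple

theorem logK_le_left (h : IsCompatibleCouple 𝕜 A₀ A₁) (f : X) (x : ℝ) :
    logK A₀ A₁ f x ≤ A₀ f := by
  have := logK_le A₀ A₁ f 0 x
  simpa [h.right.map_zero] using this

theorem logK_le_right (h : IsCompatibleCouple 𝕜 A₀ A₁) (f : X) (x : ℝ) :
    logK A₀ A₁ f x ≤ eexp x * A₁ f := by
  have := logK_le A₀ A₁ 0 f x
  simpa [h.left.map_zero] using this

theorem exists_logK_add_le (h : IsCompatibleCouple 𝕜 A₀ A₁) :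
    ∃ C : ℝ≥0, ∀ f g x, logK A₀ A₁ (f + g) x ≤ C * (logK A₀ A₁ f x + logK A₀ A₁ g x) := by
  obtain ⟨C, hC⟩ := h.left.quasi_triangle
  obtain ⟨D, hD⟩ := h.right.quasi_triangle
  have hb : ((C + D + 1 : ℝ≥0) : ℝ≥0∞) ≠ 0 := by simp
  refine ⟨C + D + 1, fun f g x => ?_⟩
  rw [← ENNReal.div_le_iff' hb ENNReal.coe_ne_top]
  refine ENNReal.le_of_forall_pos_le_add fun ε hε hfin => ?_
  have hε' : (ε / 2 : ℝ≥0∞) ≠ 0 := by simpa using hε.ne'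
  obtain ⟨f₀, f₁, hf, h1⟩ := exists_lt_of_peetreK_lt
    (ENNReal.lt_add_right (ne_top_of_le_ne_top hfin.ne le_self_add) hε')
  obtain ⟨g₀, g₁, hg, h2⟩ := exists_lt_of_peetreK_lt
    (ENNReal.lt_add_right (ne_top_of_le_ne_top hfin.ne le_add_self) hε')
  have h3 : logK A₀ A₁ (f + g) x ≤ (C + D + 1 : ℝ≥0) *
      ((A₀ f₀ + eexp x * A₁ f₁) + (A₀ g₀ + eexp x * A₁ g₁)) := by
    have : f + g = (f₀ + g₀) + (f₁ + g₁) := by rw [hf, hg]; abel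
    rw [this]
    calc _ ≤ A₀ (f₀ + g₀) + eexp x * A₁ (f₁ + g₁) := logK_le _ _ _ _ _
      _ ≤ C * (A₀ f₀ + A₀ g₀) + eexp x * (D * (A₁ f₁ + A₁ g₁)) :=
          add_le_add (hC _ _) (mul_le_mul' le_rfl (hD _ _))
      _ ≤ (C + D + 1 : ℝ≥0) * (A₀ f₀ + A₀ g₀) +
          eexp x * ((C + D + 1 : ℝ≥0) * (A₁ f₁ + A₁ g₁)) := by
          gcongr
          · rw [add_assoc]; exact le_self_add
          · rw [add_right_comm]; exact le_add_self
      _ = _ := by ring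
  rw [ENNReal.div_le_iff' hb ENNReal.coe_ne_top]
  refine h3.trans (mul_le_mul' le_rfl ((add_le_add h1.le h2.le).trans_eq ?_))
  rw [add_add_add_comm, ENNReal.add_halves]
  rfl

/-- A finite positive infimum is attained up to the factor 2. If it vanishes, continuity of the
embeddings puts f into V + V for every neighbourhood V of 0, and f = 0 since X is Hausdorff. -/
theorem exists_decomposition [IsTopologicalAddGroup X] [T2Space X]
    (h : IsCompatibleCouple 𝕜 A₀ A₁) {f : X} {x : ℝ} (hf : logK A₀ A₁ f x ≠ ∞) :
    ∃ f₀ f₁, f = f₀ + f₁ ∧ A₀ f₀ + eexp x * A₁ f₁ ≤ 2 * logK A₀ A₁ f x := by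
  by_cases h0 : logK A₀ A₁ f x = 0
  · have hf0 : f = 0 := by
      by_contra hne
      obtain ⟨V, hV, hadd⟩ := exists_nhds_zero_half (isOpen_ne.mem_nhds (Ne.symm hne))
      obtain ⟨δ₀, hδ₀, hV₀⟩ := h.left.continuous_embedding V hV
      obtain ⟨δ₁, hδ₁, hV₁⟩ := h.right.continuous_embedding V hV
      have hpos : logK A₀ A₁ f x < min δ₀ (eexp x * δ₁) := by
        rw [h0]
        exact lt_min hδ₀ (ENNReal.mul_pos (eexp_ne_zero x) hδ₁.ne')
      obtain ⟨f₀, f₁, hfs, h1⟩ := exists_lt_of_peetreK_lt hpos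
      have h2 : A₀ f₀ < δ₀ := lt_of_le_of_lt le_self_add (h1.trans_le (min_le_left _ _))
      have h3 : A₁ f₁ < δ₁ := by
        have : eexp x * A₁ f₁ < eexp x * δ₁ :=
          lt_of_le_of_lt le_add_self (h1.trans_le (min_le_right _ _))
        exact lt_of_mul_lt_mul_left' this
      exact hadd f₀ (hV₀ _ h2) f₁ (hV₁ _ h3) hfs.symm
    refine ⟨0, 0, by simp [hf0], ?_⟩
    simp [h.left.map_zero, h.right.map_zero]
  · have h1 : logK A₀ A₁ f x < 2 * logK A₀ A₁ f x := by
      rw [two_mul]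
      exact ENNReal.lt_add_right hf h0
    obtain ⟨f₀, f₁, hfs, h2⟩ := exists_lt_of_peetreK_lt h1
    exact ⟨f₀, f₁, hfs, h2.le⟩

theorem logK_neg (h : IsCompatibleCouple 𝕜 A₀ A₁) (f : X) (x : ℝ) :
    logK A₀ A₁ (-f) x = logK A₀ A₁ f x := by
  have key : ∀ g, logK A₀ A₁ (-g) x ≤ logK A₀ A₁ g x := by
    intro g
    refine le_iInf fun g₀ => le_iInf fun g₁ => le_iInf fun hg => ?_
    rw [hg, neg_add]
    refine (logK_le _ _ _ _ _).trans_eq ?_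
    rw [h.left.map_neg, h.right.map_neg]
    rfl
  refine le_antisymm (key f) ?_
  simpa using key (-f)

/-- A nearly optimal decomposition provides the truncations of the `K`-functional. -/
theorem exists_truncation [IsTopologicalAddGroup X] [T2Space X]
    (h : IsCompatibleCouple 𝕜 A₀ A₁) :
    ∃ C : ℝ≥0, ∀ f x, logK A₀ A₁ f x ≠ ∞ → ∃ f₀ f₁, f = f₀ + f₁ ∧
      (∀ y, logK A₀ A₁ f₀ y ≤ C * logK A₀ A₁ f (min y x)) ∧
      ∀ y, reflect (logK A₀ A₁ f₁) y ≤ C * reflect (logK A₀ A₁ f) (min y (-x)) := by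
  obtain ⟨C, hC⟩ := h.exists_logK_add_le
  have h2C : (2 : ℝ≥0∞) ≤ (3 * C + 2 : ℝ≥0) := by push_cast; exact le_add_self
  have h3C : (C : ℝ≥0∞) * 3 ≤ (3 * C + 2 : ℝ≥0) := by
    push_cast
    rw [mul_comm]
    exact le_self_add
  -- The 2 comes from the near-optimality of the decomposition, and 3C = C(1 + 2) from writing one
  -- summand as f minus the other.
  refine ⟨3 * C + 2, fun f x hfx => ?_⟩
  obtain ⟨f₀, f₁, hf, hle⟩ := h.exists_decomposition hfx
  have hq := logQuasiConcave_logK A₀ A₁ f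
  have h0 : ∀ y, logK A₀ A₁ f₀ y ≤ 2 * logK A₀ A₁ f x := fun y =>
    (h.logK_le_left _ _).trans (le_self_add.trans hle)
  have h1 : ∀ y, logK A₀ A₁ f₁ y ≤ eexp (y - x) * (2 * logK A₀ A₁ f x) := by
    intro y
    refine (h.logK_le_right _ _).trans ?_
    rw [← sub_add_cancel y x, eexp_add, mul_assoc, add_sub_cancel_right]
    exact mul_le_mul' le_rfl (le_add_self.trans hle)
  refine ⟨f₀, f₁, hf, fun y => ?_, fun y => ?_⟩
  · rcases le_total x y with hxy | hxy
    · rw [min_eq_right hxy]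
      exact (h0 y).trans (mul_le_mul' h2C le_rfl)
    · rw [min_eq_left hxy]
      have hs : f₀ = f + -f₁ := by rw [hf]; abel
      -- Below x, quasi-concavity gives e^{y - x} k(x) ≤ k(y), so f₁ = f - f₀ costs no more than f.
      have h2 : logK A₀ A₁ f₁ y ≤ 2 * logK A₀ A₁ f y := by
        refine (h1 y).trans ?_
        rw [mul_left_comm]
        refine mul_le_mul' le_rfl ((mul_le_mul' le_rfl (hq.le_mul y x hxy)).trans_eq ?_)
        rw [← mul_assoc, ← eexp_add, sub_add_sub_cancel, sub_self, eexp_zero, one_mul]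
      rw [hs]
      refine (hC _ _ _).trans ?_
      rw [h.logK_neg]
      refine (mul_le_mul' le_rfl (add_le_add le_rfl h2)).trans ?_
      refine le_trans (le_of_eq ?_) (mul_le_mul' h3C le_rfl)
      ring
  · rcases le_total (-x) y with hxy | hxy
    · rw [min_eq_right hxy, reflect, reflect, neg_neg]
      calc _ ≤ eexp y * (eexp (-y - x) * (2 * logK A₀ A₁ f x)) := mul_le_mul' le_rfl (h1 _)
        _ = 2 * (eexp (-x) * logK A₀ A₁ f x) := by
            rw [← mul_assoc, ← eexp_add, show y + (-y - x) = -x by ring]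
            ring
        _ ≤ _ := mul_le_mul' h2C le_rfl
    · rw [min_eq_left hxy, reflect, reflect]
      have hs : f₁ = f + -f₀ := by rw [hf]; abel
      have h2 : logK A₀ A₁ f₀ (-y) ≤ 2 * logK A₀ A₁ f (-y) :=
        (h0 _).trans (mul_le_mul' le_rfl (hq.monotone (by linarith)))
      have h3 : logK A₀ A₁ f₁ (-y) ≤ (3 * C + 2 : ℝ≥0) * logK A₀ A₁ f (-y) := by
        rw [hs]
        refine (hC _ _ _).trans ?_
        rw [h.logK_neg]
        refine (mul_le_mul' le_rfl (add_le_add le_rfl h2)).trans ?_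
        refine le_trans (le_of_eq ?_) (mul_le_mul' h3C le_rfl)
        ring
      rw [mul_left_comm]
      exact mul_le_mul' le_rfl h3

end IsCompatibleCouple

/-! ### The `K`-functional of a couple of spaces `𝓛` and `𝓡` -/

section Holmstedt

variable (D E : IterData)

/-- The function `p` is the logarithm of `t χ₀(t) / χ₁(t)`. -/
def IsLogRatio (D E : IterData) (p : ℝ → ℝ) : Prop :=
  ∀ x, eexp (p x) * E.chi (-x) = eexp x * D.chi x

variable {D E} {p : ℝ → ℝ}

/-- In `chi_mul_trunc_dominated` the quotient of the two functions χ is exactly what e^{p(x)}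
encodes. -/
theorem trunc_dominated_norm (hp : IsLogRatio D E p) {ι : Type*} {κ : ι → ℝ → ℝ≥0∞}
    (hκ : ∀ i, LogQuasiConcave (κ i)) :
    (fun i x => D.trunc (κ i) x) ≲ fun i x => eexp (p x) * E.norm (reflect (κ i)) := by
  obtain ⟨C, hC⟩ := D.chi_mul_trunc_dominated E hκ
  refine ⟨C, fun i x => (ENNReal.mul_le_mul_iff_right (E.chi_ne_zero (-x)) (E.chi_ne_top _)).1
    ((hC i x).trans_eq ?_)⟩
  dsimp only
  rw [← hp x]
  ring

/-- The same duality with D and E exchanged, applied to the reflected functions. -/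
theorem eexp_mul_trunc_dominated_norm (hp : IsLogRatio D E p) {ι : Type*} {κ : ι → ℝ → ℝ≥0∞}
    (hκ : ∀ i, LogQuasiConcave (κ i)) :
    (fun i x => eexp (p x) * E.trunc (reflect (κ i)) (-x)) ≲ fun i _ => D.norm (κ i) := by
  obtain ⟨C, hC⟩ := E.chi_mul_trunc_dominated D fun i => (hκ i).reflected
  refine ⟨C, fun i x => (ENNReal.mul_le_mul_iff_right (D.chi_ne_zero x) (D.chi_ne_top _)).1 ?_⟩
  have h1 := hC i (-x)
  simp only [neg_neg, reflect_reflect] at h1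
  calc _ = eexp (p x) * (D.chi x * E.trunc (reflect (κ i)) (-x)) := by ring
    _ ≤ eexp (p x) * (C * (eexp (-x) * E.chi (-x) * D.norm (κ i))) := mul_le_mul' le_rfl h1
    _ = C * (eexp (p x) * E.chi (-x)) * eexp (-x) * D.norm (κ i) := by ring
    _ = C * D.chi x * (eexp x * eexp (-x)) * D.norm (κ i) := by rw [hp x]; ring
    _ = _ := by rw [eexp_mul_neg]; ring

/-- Upper half of the Holmstedt formula: the decomposition of `exists_truncation` at x is tested in
the K-functional, and `exists_iterNorm_le_truncNorm` evaluates both norms. -/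
theorem logK_norm_dominated [IsTopologicalAddGroup X] [T2Space X] (hA : IsCompatibleCouple 𝕜 A₀ A₁) :
    (fun (f : X) x => logK (fun f => D.norm (logK A₀ A₁ f)) (fun f => E.norm (reflect (logK A₀ A₁ f)))
      f (p x)) ≲ fun f x =>
        D.trunc (logK A₀ A₁ f) x + eexp (p x) * E.trunc (reflect (logK A₀ A₁ f)) (-x) := by
  obtain ⟨C, hC⟩ := hA.exists_truncation
  obtain ⟨C₀, hC₀⟩ := exists_iterNorm_le_truncNorm D.r_pos D.q_pos D.slow_β D.β_ne_zero (α := D.α) C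
  obtain ⟨C₁, hC₁⟩ := exists_iterNorm_le_truncNorm E.r_pos E.q_pos E.slow_β E.β_ne_zero (α := E.α) C
  refine ⟨C₀ + C₁ + 1, fun f x => ?_⟩
  by_cases hfx : logK A₀ A₁ f x = ∞
  · have : D.trunc (logK A₀ A₁ f) x = ∞ := by
      refine top_le_iff.1 (le_trans (le_of_eq ?_) (D.chi_mul_le_trunc _ x))
      rw [hfx, ENNReal.mul_top (D.chi_ne_zero x)]
    simp only [this, top_add]
    rw [ENNReal.mul_top (by simp)]
    exact le_top
  obtain ⟨f₀, f₁, hf, h0, h1⟩ := hC f x hfx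
  have h2 : D.norm (logK A₀ A₁ f₀) ≤ C₀ * D.trunc (logK A₀ A₁ f) x := hC₀ _ _ x hfx h0
  have h3 : E.norm (reflect (logK A₀ A₁ f₁)) ≤ C₁ * E.trunc (reflect (logK A₀ A₁ f)) (-x) := by
    refine hC₁ _ _ (-x) ?_ h1
    rw [reflect, neg_neg]
    exact ENNReal.mul_ne_top (eexp_ne_top _) hfx
  calc _ ≤ D.norm (logK A₀ A₁ f₀) + eexp (p x) * E.norm (reflect (logK A₀ A₁ f₁)) := by
        conv_lhs => rw [hf]
        exact logK_le _ _ _ _ _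
    _ ≤ C₀ * D.trunc (logK A₀ A₁ f) x +
        eexp (p x) * (C₁ * E.trunc (reflect (logK A₀ A₁ f)) (-x)) :=
        add_le_add h2 (mul_le_mul' le_rfl h3)
    _ ≤ (C₀ + C₁ + 1 : ℝ≥0) * D.trunc (logK A₀ A₁ f) x +
        eexp (p x) * ((C₀ + C₁ + 1 : ℝ≥0) * E.trunc (reflect (logK A₀ A₁ f)) (-x)) := by
        gcongr
        · rw [add_assoc]; exact le_self_add
        · rw [add_right_comm]; exact le_add_self
    _ = _ := by ring

/-- Lower half of the Holmstedt formula: both truncated norms are quasi-additive. Each summand is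
controlled by its own norm through `trunc_le_norm`, and in the other truncated norm through the
duality above. -/
theorem dominated_logK_norm (hA : IsCompatibleCouple 𝕜 A₀ A₁) (hp : IsLogRatio D E p) :
    (fun (f : X) x =>
        D.trunc (logK A₀ A₁ f) x + eexp (p x) * E.trunc (reflect (logK A₀ A₁ f)) (-x)) ≲
      fun f x => logK (fun f => D.norm (logK A₀ A₁ f))
        (fun f => E.norm (reflect (logK A₀ A₁ f))) f (p x) := by
  -- Indexing by pairs makes the constants uniform over all decompositions of f.
  let κ₁ : X × X → ℝ → ℝ≥0∞ := fun g => logK A₀ A₁ g.1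
  let κ₂ : X × X → ℝ → ℝ≥0∞ := fun g => logK A₀ A₁ g.2
  let κ : X × X → ℝ → ℝ≥0∞ := fun g => logK A₀ A₁ (g.1 + g.2)
  have hκ₁ : ∀ g, LogQuasiConcave (κ₁ g) := fun g => logQuasiConcave_logK _ _ _
  have hκ₂ : ∀ g, LogQuasiConcave (κ₂ g) := fun g => logQuasiConcave_logK _ _ _
  obtain ⟨C, hC⟩ := hA.exists_logK_add_le
  have hadd : κ ≲ fun g x => κ₁ g x + κ₂ g x := ⟨C, fun g x => hC g.1 g.2 x⟩
  have haddr : (fun g => reflect (κ g)) ≲ fun g x => reflect (κ₁ g) x + reflect (κ₂ g) x := by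
    refine ⟨C, fun g x => (mul_le_mul' le_rfl (hC g.1 g.2 (-x))).trans_eq ?_⟩
    simp only [reflect, κ₁, κ₂]
    ring
  let N : X × X → ℝ → ℝ≥0∞ := fun g x => D.norm (κ₁ g) + eexp (p x) * E.norm (reflect (κ₂ g))
  have hN₀ : (fun g (_ : ℝ) => D.norm (κ₁ g)) ≲ N := .of_le fun _ _ => le_self_add
  have hN₁ : (fun g x => eexp (p x) * E.norm (reflect (κ₂ g))) ≲ N := .of_le fun _ _ => le_add_self
  have h1 : (fun g x => D.trunc (κ g) x) ≲ N := by
    refine (truncNorm_dominated_add D.r_pos D.q_pos D.slow_β D.slow_α (LogQuasiConcave.grow hκ₁)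
      (LogQuasiConcave.grow hκ₂) hadd).trans (Dominated.add_le ?_ ?_)
    · exact Dominated.trans ⟨3, fun g x => D.trunc_le_norm (hκ₁ g).monotone x⟩ hN₀
    · exact (trunc_dominated_norm hp hκ₂).trans hN₁
  have h2 : (fun g x => eexp (p x) * E.trunc (reflect (κ g)) (-x)) ≲ N := by
    obtain ⟨C', hC'⟩ := truncNorm_dominated_add E.r_pos E.q_pos E.slow_β E.slow_α
      (LogQuasiConcave.grow fun g => (hκ₁ g).reflected)
      (LogQuasiConcave.grow fun g => (hκ₂ g).reflected) haddr
    have h3 : (fun g x => eexp (p x) * E.trunc (reflect (κ g)) (-x)) ≲ fun g x =>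
        eexp (p x) * E.trunc (reflect (κ₁ g)) (-x) + eexp (p x) * E.trunc (reflect (κ₂ g)) (-x) := by
      refine ⟨C', fun g x => (mul_le_mul' le_rfl (hC' g (-x))).trans_eq ?_⟩
      simp only [IterData.trunc]
      ring
    refine h3.trans (Dominated.add_le ((eexp_mul_trunc_dominated_norm hp hκ₁).trans hN₀) ?_)
    refine Dominated.trans ⟨3, fun g x => ?_⟩ hN₁
    refine (mul_le_mul' le_rfl (E.trunc_le_norm (hκ₂ g).reflected.monotone (-x))).trans_eq ?_
    rw [mul_left_comm]
    rfl
  obtain ⟨C', hC'⟩ := Dominated.add_le h1 h2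
  refine ⟨C' + 1, fun f x => le_mul_peetreK fun f₀ f₁ hf => ?_⟩
  subst hf
  exact hC' (f₀, f₁) x

end Holmstedt

end KFunctional

/-! ### Interpolation in the logarithmic variable -/

theorem lqNorm_univ_comp_neg (q : ℝ≥0∞) (F : ℝ → ℝ≥0∞) :
    lqNorm q univ (fun x => F (-x)) = lqNorm q univ F :=
  lqNorm_comp_neg q univ F

namespace IterData

variable (D : IterData) {ι : Type*} {κ : ι → ℝ → ℝ≥0∞} {p : ℝ≥0∞} {w : ℝ → ℝ≥0∞}

/-- The first part of the norm of a truncation. -/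
def inner₂ (k : ℝ → ℝ≥0∞) (x : ℝ) : ℝ≥0∞ :=
  lqNorm D.r (Iio x) fun s => D.β s * lqNorm D.q (Iio s) fun u => D.α u * k u

/-- The second part of the norm of a truncation. -/
def inner₁ (k : ℝ → ℝ≥0∞) (x : ℝ) : ℝ≥0∞ :=
  tailNorm D.r D.β x * lqNorm D.q (Iio x) fun u => D.α u * k u

/-- In the limiting cases θ = 0 and θ = 1 these three terms become the three intersected spaces. -/
theorem lqNorm_trunc_dominated (hp : 0 < p) (hw : Grow fun _ : ι => w) (hκ : Grow κ) :
    (fun i (_ : ℝ) => lqNorm p univ fun x => w x * D.trunc (κ i) x) ≲ fun i _ =>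
      max (max (lqNorm p univ fun x => w x * (D.chi x * κ i x))
        (lqNorm p univ fun x => w x * D.inner₁ (κ i) x))
        (lqNorm p univ fun x => w x * D.inner₂ (κ i) x) := by
  have hS : ∀ _ : ℝ, MeasurableSet (univ : Set ℝ) := fun _ => .univ
  have h2 : Grow fun i x => w x * D.inner₂ (κ i) x :=
    hw.mul (hκ.lqNorm_lqNorm_mul D.r_pos D.q_pos D.slow_β D.slow_α)
  have h1 : Grow fun i x => w x * D.inner₁ (κ i) x :=
    hw.mul ((Grow.of_slow (D.slow_β.slow_tailNorm D.r_pos)).mul (hκ.lqNorm_mul D.q_pos D.slow_α))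
  have h0 : Grow fun i x => w x * (D.chi x * κ i x) :=
    hw.mul ((Grow.of_slow D.slow_chi).mul hκ)
  have h3 := Grow.lqNorm_add hp hS (h2.add h1) h0
  refine Dominated.trans (.of_le fun i _ => le_of_eq ?_) (h3.trans (Dominated.add_le
    ((Grow.lqNorm_add hp hS h2 h1).trans (Dominated.add_le (.of_le fun i _ => ?_)
      (.of_le fun i _ => ?_))) (.of_le fun i _ => ?_)))
  · congr 1
    funext x
    rw [← mul_add, ← mul_add]
    rfl
  · exact le_max_right _ _
  · exact (le_max_right _ _).trans (le_max_left _ _)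
  · exact (le_max_left _ _).trans (le_max_left _ _)

theorem max_le_lqNorm_trunc (k : ℝ → ℝ≥0∞) :
    max (max (lqNorm p univ fun x => w x * (D.chi x * k x))
        (lqNorm p univ fun x => w x * D.inner₁ k x))
        (lqNorm p univ fun x => w x * D.inner₂ k x) ≤
      lqNorm p univ fun x => w x * D.trunc k x := by
  refine max_le (max_le ?_ ?_) ?_ <;> refine lqNorm_mono .univ fun x _ => mul_le_mul' le_rfl ?_
  · exact le_add_self
  · exact le_trans le_add_self le_self_add
  · exact le_trans le_self_add le_self_add

end IterData

theorem SameSpace.of_dominated {X : Type*} {N M : X → ℝ≥0∞}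
    (h : (fun f (_ : ℝ) => N f) ≲ fun f _ => M f)
    (h' : (fun f (_ : ℝ) => M f) ≲ fun f _ => N f) : SameSpace N M := by
  obtain ⟨C, hC⟩ := h
  obtain ⟨C', hC'⟩ := h'
  exact ⟨⟨C', fun f _ => hC' f 0⟩, ⟨C, fun f _ => hC f 0⟩⟩

section LogInterpolation

variable {X : Type*} [AddCommGroup X] {A₀ A₁ : X → ℝ≥0∞} {D E : IterData} {p : ℝ → ℝ}
  {r : ℝ≥0∞} {a : ℝ → ℝ≥0∞}

/-- The norm of the interpolation space, in the logarithmic variable. -/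
def logInterp (A₀ A₁ : X → ℝ≥0∞) (θ : ℝ) (r : ℝ≥0∞) (a : ℝ → ℝ≥0∞) (f : X) : ℝ≥0∞ :=
  lqNorm r univ fun x => eexp (-(θ * x)) * a x * logK A₀ A₁ f x

theorem grow_logK (A₀ A₁ : X → ℝ≥0∞) : Grow (logK A₀ A₁) :=
  LogQuasiConcave.grow (logQuasiConcave_logK A₀ A₁)

theorem grow_reflect_logK (A₀ A₁ : X → ℝ≥0∞) : Grow fun f => reflect (logK A₀ A₁ f) :=
  LogQuasiConcave.grow fun f => (logQuasiConcave_logK A₀ A₁ f).reflected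

theorem grow_weight {ι : Type*} (ha : Slow a) (θ : ℝ) :
    Grow fun (_ : ι) x => eexp (-(θ * x)) * a x := by
  have he : Grow fun (_ : ι) x => eexp (-(θ * x)) := by simpa using grow_eexp (ι := ι) (-θ)
  exact he.mul (.of_slow ha)

theorem grow_weight_comp {ι : Type*} (ht : AlmostTranslation p) (ha : Slow a) (θ : ℝ) :
    Grow fun (_ : ι) x => eexp (-(θ * p x)) * a (p x) :=
  ht.grow_comp (grow_weight ha θ)

/-- The part of the norm which comes from the first space of the couple. -/
def leftPart (A₀ A₁ : X → ℝ≥0∞) (D : IterData) (p : ℝ → ℝ) (θ : ℝ) (r : ℝ≥0∞) (a : ℝ → ℝ≥0∞)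
    (f : X) : ℝ≥0∞ :=
  lqNorm r univ fun x => eexp (-(θ * p x)) * a (p x) * D.trunc (logK A₀ A₁ f) x

/-- The part of the norm which comes from the second space of the couple. -/
def rightPart (A₀ A₁ : X → ℝ≥0∞) (E : IterData) (p : ℝ → ℝ) (θ : ℝ) (r : ℝ≥0∞) (a : ℝ → ℝ≥0∞)
    (f : X) : ℝ≥0∞ :=
  lqNorm r univ fun x =>
    eexp ((1 - θ) * p (-x)) * a (p (-x)) * E.trunc (reflect (logK A₀ A₁ f)) x

/-- The part of the norm which is common to both. -/
def commonPart (A₀ A₁ : X → ℝ≥0∞) (D : IterData) (p : ℝ → ℝ) (θ : ℝ) (r : ℝ≥0∞) (a : ℝ → ℝ≥0∞)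
    (f : X) : ℝ≥0∞ :=
  lqNorm r univ fun x => eexp (-(θ * p x)) * a (p x) * (D.chi x * logK A₀ A₁ f x)

theorem rightPart_eq (A₀ A₁ : X → ℝ≥0∞) (E : IterData) (p : ℝ → ℝ) (θ : ℝ) (r : ℝ≥0∞)
    (a : ℝ → ℝ≥0∞) (f : X) : rightPart A₀ A₁ E p θ r a f = lqNorm r univ fun x =>
      eexp (-(θ * p x)) * a (p x) * (eexp (p x) * E.trunc (reflect (logK A₀ A₁ f)) (-x)) := by
  rw [rightPart, ← lqNorm_univ_comp_neg]
  congr 1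
  funext x
  rw [neg_neg, sub_mul, one_mul, sub_eq_neg_add, eexp_add]
  ring

/-- The relation e^p χ₁ = e^x χ₀ makes the last terms of the left and right truncated norms
coincide. -/
theorem commonPart_eq (hp : IsLogRatio D E p) (A₀ A₁ : X → ℝ≥0∞) (θ : ℝ) (r : ℝ≥0∞)
    (a : ℝ → ℝ≥0∞) (f : X) : commonPart A₀ A₁ D p θ r a f = lqNorm r univ fun x =>
      eexp ((1 - θ) * p (-x)) * a (p (-x)) * (E.chi x * reflect (logK A₀ A₁ f) x) := by
  rw [commonPart, ← lqNorm_univ_comp_neg]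
  congr 1
  funext x
  have h := hp (-x)
  rw [neg_neg] at h
  calc _ = eexp (-(θ * p (-x))) * a (p (-x)) * (eexp x * eexp (-x)) * D.chi (-x) *
        logK A₀ A₁ f (-x) := by rw [eexp_mul_neg]; ring
    _ = eexp (-(θ * p (-x))) * a (p (-x)) * eexp x * (eexp (-x) * D.chi (-x)) *
        logK A₀ A₁ f (-x) := by ring
    _ = _ := by
      rw [← h, reflect, sub_mul, one_mul, sub_eq_neg_add, eexp_add]
      ring

theorem commonPart_le_leftPart (A₀ A₁ : X → ℝ≥0∞) (D : IterData) (p : ℝ → ℝ) (θ : ℝ) (r : ℝ≥0∞)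
    (a : ℝ → ℝ≥0∞) (f : X) : commonPart A₀ A₁ D p θ r a f ≤ leftPart A₀ A₁ D p θ r a f :=
  lqNorm_mono .univ fun x _ => mul_le_mul' le_rfl (D.chi_mul_le_trunc _ x)

/-- The weight e^{-θ p} is e^{-θ x} times the slow factor e^{-θ (p - x)}, so Hardy's inequality
applies as soon as θ > 0. -/
theorem leftPart_dominated (hr : 0 < r) (ha : Slow a) (ht : AlmostTranslation p) {θ : ℝ}
    (hθ : 0 < θ) : (fun f (_ : ℝ) => leftPart A₀ A₁ D p θ r a f) ≲
      fun f _ => commonPart A₀ A₁ D p θ r a f := by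
  have h := D.hardy (grow_logK A₀ A₁) hr ((ht.slow_eexp (-θ)).mul (ht.slow_comp ha)) hθ
  have hw : ∀ x, eexp (-(θ * x)) * (eexp (-θ * (p x - x)) * a (p x)) =
      eexp (-(θ * p x)) * a (p x) := by
    intro x
    rw [← mul_assoc, ← eexp_add]
    ring_nf
  simpa only [hw] using! h

/-- After reflection the weight decays at rate 1 - θ, hence the condition θ < 1. -/
theorem rightPart_dominated (hr : 0 < r) (ha : Slow a) (ht : AlmostTranslation p)
    (hp : IsLogRatio D E p) {θ : ℝ} (hθ : θ < 1) :
    (fun f (_ : ℝ) => rightPart A₀ A₁ E p θ r a f) ≲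
      fun f _ => commonPart A₀ A₁ D p θ r a f := by
  have h := E.hardy (grow_reflect_logK A₀ A₁) hr
    ((ht.slow_eexp (1 - θ)).mul (ht.slow_comp ha)).comp_neg (sub_pos.2 hθ)
  have hw : ∀ x, eexp (-((1 - θ) * x)) * (eexp ((1 - θ) * (p (-x) - -x)) * a (p (-x))) =
      eexp ((1 - θ) * p (-x)) * a (p (-x)) := by
    intro x
    rw [← mul_assoc, ← eexp_add]
    ring_nf
  simp only [commonPart_eq hp]
  simpa only [hw] using! h

variable {𝕜 : Type*} [RCLike 𝕜] [Module 𝕜 X] [TopologicalSpace X]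

theorem logInterp_dominated [IsTopologicalAddGroup X] [T2Space X]
    (hA : IsCompatibleCouple 𝕜 A₀ A₁) (hr : 0 < r) (ha : Slow a) (ht : AlmostTranslation p)
    (θ : ℝ) :
    (fun f (_ : ℝ) => logInterp (fun f => D.norm (logK A₀ A₁ f))
      (fun f => E.norm (reflect (logK A₀ A₁ f))) θ r a f) ≲
      fun f _ => leftPart A₀ A₁ D p θ r a f + rightPart A₀ A₁ E p θ r a f := by
  have hw := grow_weight_comp (ι := X) ht ha θ
  have he : Grow fun (_ : X) x => eexp (p x) := by simpa using ht.grow_comp (grow_eexp (ι := X) 1)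
  have hE : Grow fun (f : X) x => E.trunc (reflect (logK A₀ A₁ f)) (-x) := by
    obtain ⟨M, hM, C, hC⟩ := E.grow_trunc (grow_reflect_logK A₀ A₁)
    refine ⟨M, hM, C, fun i x y => (hC i (-x) (-y)).trans_eq ?_⟩
    rw [neg_sub_neg, abs_sub_comm]
  refine (ht.lqNorm_dominated_comp hr ((grow_weight ha θ).mul (grow_logK _ _))).trans ?_
  simp only [rightPart_eq]
  refine Dominated.trans ?_ ((hw.mul (D.grow_trunc (grow_logK A₀ A₁))).lqNorm_add hr
    (fun _ => .univ) (hw.mul (he.mul hE)))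
  refine Dominated.comp_lqNorm hr (fun _ => .univ) ?_
  simpa only [mul_add] using (logK_norm_dominated hA).mul_left _

theorem dominated_logInterp (hA : IsCompatibleCouple 𝕜 A₀ A₁) (hr : 0 < r) (ha : Slow a)
    (ht : AlmostTranslation p) (hp : IsLogRatio D E p) (θ : ℝ) :
    (fun f (_ : ℝ) => leftPart A₀ A₁ D p θ r a f + rightPart A₀ A₁ E p θ r a f) ≲
      fun f _ => logInterp (fun f => D.norm (logK A₀ A₁ f))
        (fun f => E.norm (reflect (logK A₀ A₁ f))) θ r a f := by
  refine Dominated.trans ?_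
    (ht.lqNorm_comp_dominated hr ((grow_weight ha θ).mul (grow_logK _ _)))
  have h := (dominated_logK_norm (D := D) (E := E) hA hp).mul_left
    fun x => eexp (-(θ * p x)) * a (p x)
  simp only [rightPart_eq]
  refine Dominated.add_le ?_ ?_ <;>
    refine Dominated.comp_lqNorm hr (fun _ => .univ) (Dominated.trans (.of_le fun f x => ?_) h)
  · exact mul_le_mul' le_rfl le_self_add
  · exact mul_le_mul' le_rfl le_add_self

variable [IsTopologicalAddGroup X] [T2Space X]

theorem sameSpace_commonPart (hA : IsCompatibleCouple 𝕜 A₀ A₁) (hr : 0 < r) (ha : Slow a)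
    (ht : AlmostTranslation p) (hp : IsLogRatio D E p) {θ : ℝ} (hθ : 0 < θ) (hθ' : θ < 1) :
    SameSpace (logInterp (fun f => D.norm (logK A₀ A₁ f))
        (fun f => E.norm (reflect (logK A₀ A₁ f))) θ r a)
      (commonPart A₀ A₁ D p θ r a) :=
  .of_dominated ((logInterp_dominated hA hr ha ht θ).trans
      (.add_le (leftPart_dominated hr ha ht hθ) (rightPart_dominated hr ha ht hp hθ')))
    (.trans (.of_le fun f _ => (commonPart_le_leftPart A₀ A₁ D p θ r a f).trans le_self_add)
      (dominated_logInterp hA hr ha ht hp θ))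

/-- At θ = 0 the left weight has no decay, so all three terms of the left truncated norm remain; the
right part is still absorbed by the common part. -/
theorem sameSpace_left (hA : IsCompatibleCouple 𝕜 A₀ A₁) (hr : 0 < r) (ha : Slow a)
    (ht : AlmostTranslation p) (hp : IsLogRatio D E p) :
    SameSpace (logInterp (fun f => D.norm (logK A₀ A₁ f))
        (fun f => E.norm (reflect (logK A₀ A₁ f))) 0 r a)
      (interNorm (interNorm (commonPart A₀ A₁ D p 0 r a)
        (fun f => lqNorm r univ fun x => a (p x) * D.inner₁ (logK A₀ A₁ f) x))
        (fun f => lqNorm r univ fun x => a (p x) * D.inner₂ (logK A₀ A₁ f) x)) := by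
  have hw : Grow fun (_ : X) x => a (p x) := .of_slow (ht.slow_comp ha)
  have h1 : ∀ f, leftPart A₀ A₁ D p 0 r a f =
      lqNorm r univ fun x => a (p x) * D.trunc (logK A₀ A₁ f) x := by
    simp [leftPart, eexp_zero]
  have h2 : ∀ f, commonPart A₀ A₁ D p 0 r a f =
      lqNorm r univ fun x => a (p x) * (D.chi x * logK A₀ A₁ f x) := by
    simp [commonPart, eexp_zero]
  have h3 := D.lqNorm_trunc_dominated hr hw (grow_logK A₀ A₁)
  refine .of_dominated ((logInterp_dominated hA hr ha ht 0).trans (.add_le ?_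
    ((rightPart_dominated hr ha ht hp one_pos).trans (.of_le fun f _ => ?_))))
    (.trans (.of_le fun f _ => ?_) (dominated_logInterp hA hr ha ht hp 0))
  · simpa only [h1, interNorm, h2] using h3
  · exact (le_max_left _ _).trans (le_max_left _ _)
  · refine le_trans ?_ le_self_add
    simp only [interNorm, h1, h2]
    exact D.max_le_lqNorm_trunc _

theorem sameSpace_right (hA : IsCompatibleCouple 𝕜 A₀ A₁) (hr : 0 < r) (ha : Slow a)
    (ht : AlmostTranslation p) (hp : IsLogRatio D E p) :
    SameSpace (logInterp (fun f => D.norm (logK A₀ A₁ f))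
        (fun f => E.norm (reflect (logK A₀ A₁ f))) 1 r a)
      (interNorm (interNorm (commonPart A₀ A₁ D p 1 r a)
        (fun f => lqNorm r univ fun x => a (p x) * E.inner₁ (reflect (logK A₀ A₁ f)) (-x)))
        (fun f => lqNorm r univ fun x => a (p x) * E.inner₂ (reflect (logK A₀ A₁ f)) (-x))) := by
  have hw : Grow fun (_ : X) x => a (p (-x)) := .of_slow (ht.slow_comp ha).comp_neg
  have h1 : ∀ f, rightPart A₀ A₁ E p 1 r a f =
      lqNorm r univ fun x => a (p (-x)) * E.trunc (reflect (logK A₀ A₁ f)) x := by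
    simp [rightPart, eexp_zero]
  have h2 : ∀ f, commonPart A₀ A₁ D p 1 r a f =
      lqNorm r univ fun x => a (p (-x)) * (E.chi x * reflect (logK A₀ A₁ f) x) := by
    simp [commonPart_eq hp, eexp_zero]
  have hn : ∀ (G : (ℝ → ℝ≥0∞) → ℝ → ℝ≥0∞) (f : X),
      (lqNorm r univ fun x => a (p x) * G (reflect (logK A₀ A₁ f)) (-x)) =
        lqNorm r univ fun x => a (p (-x)) * G (reflect (logK A₀ A₁ f)) x := by
    intro G f
    rw [← lqNorm_univ_comp_neg]
    simp only [neg_neg]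
  have h3 := E.lqNorm_trunc_dominated hr hw (grow_reflect_logK A₀ A₁)
  refine .of_dominated ((logInterp_dominated hA hr ha ht 1).trans (.add_le
    ((leftPart_dominated hr ha ht one_pos).trans (.of_le fun f _ => ?_)) ?_))
    (.trans (.of_le fun f _ => ?_) (dominated_logInterp hA hr ha ht hp 1))
  · exact (le_max_left _ _).trans (le_max_left _ _)
  · simpa only [h1, interNorm, h2, hn] using h3
  · refine le_trans ?_ le_add_self
    simp only [interNorm, h1, h2, hn]
    exact E.max_le_lqNorm_trunc _

end LogInterpolation

/-! ### The logarithmic change of variable -/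

theorem image_exp_preimage {I : Set ℝ} (hI : I ⊆ Ioi 0) : Real.exp '' (Real.exp ⁻¹' I) = I := by
  rw [image_preimage_eq_iff, Real.range_exp]
  exact hI

/-- Both exp and log are differentiable on the relevant sets and so map null sets to null sets. -/
theorem essSup_comp_exp {I : Set ℝ} (hI : MeasurableSet I) (hI0 : I ⊆ Ioi 0) (F : ℝ → ℝ≥0∞) :
    essSup F (volume.restrict I) =
      essSup (fun x => F (Real.exp x)) (volume.restrict (Real.exp ⁻¹' I)) := by
  have key : ∀ c, (∀ᵐ u ∂volume.restrict I, F u ≤ c) ↔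
      ∀ᵐ x ∂volume.restrict (Real.exp ⁻¹' I), F (Real.exp x) ≤ c := by
    intro c
    rw [ae_restrict_iff' hI, ae_restrict_iff' (Real.measurable_exp hI), ae_iff, ae_iff]
    set S := {u | ¬(u ∈ I → F u ≤ c)}
    have hS : S ⊆ Ioi 0 := fun u hu => hI0 (Classical.not_imp.1 hu).1
    change volume S = 0 ↔ volume (Real.exp ⁻¹' S) = 0
    constructor <;> intro h
    · have : Real.exp ⁻¹' S = Real.log '' S := by
        ext x
        constructor
        · exact fun hx => ⟨_, hx, Real.log_exp x⟩
        · rintro ⟨u, hu, rfl⟩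
          rwa [mem_preimage, Real.exp_log (hS hu)]
      rw [this]
      exact addHaar_image_eq_zero_of_differentiableOn_of_addHaar_eq_zero volume
        (fun u hu => (Real.differentiableAt_log (ne_of_gt (hS hu))).differentiableWithinAt) h
    · rw [← image_exp_preimage hS]
      exact addHaar_image_eq_zero_of_differentiableOn_of_addHaar_eq_zero volume
        Real.differentiable_exp.differentiableOn h
  refine eq_of_forall_ge_iff fun c => ?_
  have h1 : ∀ (μ : Measure ℝ) (G : ℝ → ℝ≥0∞), essSup G μ ≤ c ↔ ∀ᵐ x ∂μ, G x ≤ c := fun μ G =>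
    ⟨fun h => (ENNReal.ae_le_essSup G).mono fun x hx => hx.trans h,
      fun h => essSup_le_of_ae_le c h⟩
  rw [h1, h1, key]

/-- The q-th power of u^{-1/q} cancels the Jacobian e^x; for q = ∞ neither factor is present. -/
theorem weightedNorm_eq_log {q : ℝ≥0∞} (hq : 0 < q) (l : ℝ) (b : ℝ → ℝ) {I : Set ℝ}
    (hI : MeasurableSet I) (hI0 : I ⊆ Ioi 0) (F : ℝ → ℝ≥0∞) :
    weightedNorm l q b I F = lqNorm q (Real.exp ⁻¹' I)
      fun x => eexp (l * x) * ENNReal.ofReal (b (Real.exp x)) * F (Real.exp x) := by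
  have hexp : ∀ x m b', ENNReal.ofReal (Real.exp x ^ m * b') =
      eexp (m * x) * ENNReal.ofReal b' := by
    intro x m b'
    rw [ENNReal.ofReal_mul (by positivity), ← Real.exp_mul, mul_comm x]
    rfl
  unfold weightedNorm
  by_cases hq' : q = ∞
  · subst hq'
    rw [lqNorm_top, lqNorm_top, essSup_comp_exp hI hI0]
    simp only [hexp, ENNReal.inv_top, ENNReal.toReal_zero, sub_zero]
  · have h := ENNReal.toReal_pos hq.ne' hq'
    rw [lqNorm_eq hq hq', lqNorm_eq hq hq']
    congr 1
    nth_rw 1 [← image_exp_preimage hI0]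
    rw [lintegral_image_eq_lintegral_abs_deriv_mul (Real.measurable_exp hI)
      (fun x _ => (Real.hasDerivAt_exp x).hasDerivWithinAt) Real.exp_injective.injOn]
    refine lintegral_congr fun x => ?_
    have h1 : eexp ((l - q⁻¹.toReal) * x) ^ q.toReal * eexp x = eexp (l * x) ^ q.toReal := by
      simp only [eexp]
      rw [ENNReal.ofReal_rpow_of_pos (Real.exp_pos _), ENNReal.ofReal_rpow_of_pos (Real.exp_pos _),
        ← ENNReal.ofReal_mul (by positivity), ← Real.exp_mul, ← Real.exp_mul, ← Real.exp_add,
        ENNReal.toReal_inv]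
      congr 2
      field_simp
      ring
    rw [hexp, abs_of_pos (Real.exp_pos x), ENNReal.mul_rpow_of_nonneg _ _ h.le,
      ENNReal.mul_rpow_of_nonneg _ _ h.le, ENNReal.mul_rpow_of_nonneg _ _ h.le,
      ENNReal.mul_rpow_of_nonneg _ _ h.le, ← h1, eexp.eq_def x]
    ring

theorem weightedNorm_Ioi_zero {q : ℝ≥0∞} (hq : 0 < q) (l : ℝ) (b : ℝ → ℝ) (F : ℝ → ℝ≥0∞) :
    weightedNorm l q b (Ioi 0) F = lqNorm q univ
      fun x => eexp (l * x) * ENNReal.ofReal (b (Real.exp x)) * F (Real.exp x) := by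
  rw [weightedNorm_eq_log hq l b measurableSet_Ioi subset_rfl]
  congr 1
  ext x
  simp [Real.exp_pos]

theorem weightedNorm_Ioi_exp {q : ℝ≥0∞} (hq : 0 < q) (l : ℝ) (b : ℝ → ℝ) (F : ℝ → ℝ≥0∞) (y : ℝ) :
    weightedNorm l q b (Ioi (Real.exp y)) F = lqNorm q (Ioi y)
      fun x => eexp (l * x) * ENNReal.ofReal (b (Real.exp x)) * F (Real.exp x) := by
  rw [weightedNorm_eq_log hq l b measurableSet_Ioi (Ioi_subset_Ioi (Real.exp_pos y).le)]
  congr 1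
  ext x
  simp

theorem weightedNorm_Ioo_zero_exp {q : ℝ≥0∞} (hq : 0 < q) (l : ℝ) (b : ℝ → ℝ) (F : ℝ → ℝ≥0∞)
    (y : ℝ) : weightedNorm l q b (Ioo 0 (Real.exp y)) F = lqNorm q (Iio y)
      fun x => eexp (l * x) * ENNReal.ofReal (b (Real.exp x)) * F (Real.exp x) := by
  rw [weightedNorm_eq_log hq l b measurableSet_Ioo Ioo_subset_Ioi_self]
  congr 1
  ext x
  simp [Real.exp_pos]

theorem weightedNorm_Ioo_exp {q : ℝ≥0∞} (hq : 0 < q) (l : ℝ) (b : ℝ → ℝ) (F : ℝ → ℝ≥0∞)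
    (y z : ℝ) : weightedNorm l q b (Ioo (Real.exp y) (Real.exp z)) F = lqNorm q (Ioo y z)
      fun x => eexp (l * x) * ENNReal.ofReal (b (Real.exp x)) * F (Real.exp x) := by
  rw [weightedNorm_eq_log hq l b measurableSet_Ioo
    (Ioo_subset_Ioi_self.trans (Ioi_subset_Ioi (Real.exp_pos y).le))]
  congr 1
  ext x
  simp

theorem lqNorm_Ioi_eq_neg (q : ℝ≥0∞) (x : ℝ) (F : ℝ → ℝ≥0∞) :
    lqNorm q (Ioi x) F = lqNorm q (Iio (-x)) fun u => F (-u) := by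
  rw [← lqNorm_comp_neg q (Ioi x)]
  congr 1
  ext u
  simp only [mem_preimage, mem_Ioi, mem_Iio]
  constructor <;> intro <;> linarith

theorem lqNorm_Iio_eq_neg (q : ℝ≥0∞) (x : ℝ) (F : ℝ → ℝ≥0∞) :
    lqNorm q (Iio x) F = lqNorm q (Ioi (-x)) fun u => F (-u) := by
  rw [lqNorm_Ioi_eq_neg, neg_neg]
  simp only [neg_neg]

theorem lqNorm_Ioo_eq_neg (q : ℝ≥0∞) (x y : ℝ) (F : ℝ → ℝ≥0∞) :
    lqNorm q (Ioo x y) F = lqNorm q (Ioo (-y) (-x)) fun u => F (-u) := by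
  rw [← lqNorm_comp_neg q (Ioo x y)]
  congr 1
  ext u
  simp only [mem_preimage, mem_Ioo]
  constructor <;> rintro ⟨_, _⟩ <;> constructor <;> linarith

/-- A weight in the logarithmic variable. -/
def logWeight (b : ℝ → ℝ) (x : ℝ) : ℝ≥0∞ := ENNReal.ofReal (b (Real.exp x))

theorem SlowlyVarying.logWeight_ne_zero {b : ℝ → ℝ} (hb : SlowlyVarying b) (x : ℝ) :
    logWeight b x ≠ 0 := by
  simpa [logWeight] using hb.pos _ (Real.exp_pos x)

/-- The increasing equivalent gives the bound for x ≤ y and the decreasing one for y ≤ x. The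
constants are squared because each equivalence is used at both points. -/
theorem SlowlyVarying.slow {b : ℝ → ℝ} (hb : SlowlyVarying b) : Slow (logWeight b) := by
  intro ε hε
  obtain ⟨g, hg, C, hC, hgb⟩ := hb.equiv_increasing ε hε
  obtain ⟨h, hh, D, hD, hhb⟩ := hb.equiv_decreasing ε hε
  have hE : 0 ≤ C * C + D * D := by positivity
  refine ⟨(C * C + D * D).toNNReal, fun x y => ?_⟩
  have key : b (Real.exp x) ≤ (C * C + D * D) * Real.exp (ε * |x - y|) * b (Real.exp y) := by
    have hby := hb.pos _ (Real.exp_pos y)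
    rcases le_total x y with hxy | hxy
    · have h1 := (hgb _ (Real.exp_pos x)).1
      have h2 := (hgb _ (Real.exp_pos y)).2
      have h3 := hg (mem_Ioi.2 (Real.exp_pos x)) (mem_Ioi.2 (Real.exp_pos y))
        (Real.exp_le_exp.2 hxy)
      dsimp only at h1 h2
      rw [← Real.exp_mul] at h1 h2
      have h4 : Real.exp (x * ε) * b (Real.exp x) ≤ C * (C * (Real.exp (y * ε) * b (Real.exp y))) :=
        h1.trans (mul_le_mul_of_nonneg_left (h3.trans h2) hC.le)
      have h5 : Real.exp (y * ε) = Real.exp (x * ε) * Real.exp (ε * |x - y|) := by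
        rw [← Real.exp_add, abs_of_nonpos (sub_nonpos.2 hxy)]
        ring_nf
      rw [h5] at h4
      have h6 : b (Real.exp x) ≤ C * C * Real.exp (ε * |x - y|) * b (Real.exp y) := by
        refine le_of_mul_le_mul_left (h4.trans_eq ?_) (Real.exp_pos (x * ε))
        ring
      refine h6.trans ?_
      gcongr
      nlinarith
    · have h1 := (hhb _ (Real.exp_pos x)).1
      have h2 := (hhb _ (Real.exp_pos y)).2
      have h3 := hh (mem_Ioi.2 (Real.exp_pos y)) (mem_Ioi.2 (Real.exp_pos x))
        (Real.exp_le_exp.2 hxy)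
      dsimp only at h1 h2
      rw [← Real.exp_mul] at h1 h2
      have h4 : Real.exp (x * -ε) * b (Real.exp x) ≤
          D * (D * (Real.exp (y * -ε) * b (Real.exp y))) :=
        h1.trans (mul_le_mul_of_nonneg_left (h3.trans h2) hD.le)
      have h5 : Real.exp (y * -ε) = Real.exp (x * -ε) * Real.exp (ε * |x - y|) := by
        rw [← Real.exp_add, abs_of_nonneg (sub_nonneg.2 hxy)]
        ring_nf
      rw [h5] at h4
      have h6 : b (Real.exp x) ≤ D * D * Real.exp (ε * |x - y|) * b (Real.exp y) := by
        refine le_of_mul_le_mul_left (h4.trans_eq ?_) (Real.exp_pos (x * -ε))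
        ring
      refine h6.trans ?_
      gcongr
      nlinarith
  refine (ENNReal.ofReal_le_ofReal key).trans_eq ?_
  rw [ENNReal.ofReal_mul (by positivity), ENNReal.ofReal_mul hE]
  rfl

/-! ### The norms of the spaces in the logarithmic variable -/

section Transfer

variable {X : Type*} [AddCommGroup X] {A₀ A₁ : X → ℝ≥0∞} {r q : ℝ≥0∞} {a b : ℝ → ℝ}

theorem interp_eq_logInterp (hr : 0 < r) (A₀ A₁ : X → ℝ≥0∞) (θ : ℝ) (b : ℝ → ℝ) :
    interp A₀ A₁ θ r b = logInterp A₀ A₁ θ r (logWeight b) := by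
  funext f
  unfold interp
  rw [weightedNorm_Ioi_zero hr]
  simp only [neg_mul]
  rfl

theorem tailIterNorm_logWeight (hr : 0 < r) (hq : 0 < q) (a b : ℝ → ℝ) (x : ℝ) :
    tailIterNorm r (logWeight b) q (logWeight a) x = weightedNorm 0 r b (Ioi (Real.exp x))
      fun s => weightedNorm 0 q a (Ioo (Real.exp x) s) fun _ => 1 := by
  rw [weightedNorm_Ioi_exp hr, tailIterNorm]
  simp only [weightedNorm_Ioo_exp hq, zero_mul, eexp_zero, one_mul, mul_one]
  rfl

theorem tailIterNorm_logWeight_neg (hr : 0 < r) (hq : 0 < q) (a b : ℝ → ℝ) (x : ℝ) :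
    tailIterNorm r (fun x => logWeight b (-x)) q (fun x => logWeight a (-x)) (-x) =
      weightedNorm 0 r b (Ioo 0 (Real.exp x))
        fun s => weightedNorm 0 q a (Ioo s (Real.exp x)) fun _ => 1 := by
  rw [weightedNorm_Ioo_zero_exp hr, tailIterNorm, lqNorm_Iio_eq_neg]
  simp only [weightedNorm_Ioo_exp hq, zero_mul, eexp_zero, one_mul, mul_one]
  congr 1
  funext s
  rw [lqNorm_Ioo_eq_neg q (-s), neg_neg]
  rfl

theorem tailNorm_logWeight (hr : 0 < r) (b : ℝ → ℝ) (x : ℝ) :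
    tailNorm r (logWeight b) x = weightedNorm 0 r b (Ioi (Real.exp x)) fun _ => 1 := by
  rw [weightedNorm_Ioi_exp hr, tailNorm]
  simp only [zero_mul, eexp_zero, one_mul, mul_one]
  rfl

theorem tailNorm_logWeight_neg (hr : 0 < r) (b : ℝ → ℝ) (x : ℝ) :
    tailNorm r (fun x => logWeight b (-x)) (-x) =
      weightedNorm 0 r b (Ioo 0 (Real.exp x)) fun _ => 1 := by
  rw [weightedNorm_Ioo_zero_exp hr, tailNorm, lqNorm_Iio_eq_neg]
  simp only [zero_mul, eexp_zero, one_mul, mul_one]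
  rfl

theorem weightedNorm_Ioo_logK (hq : 0 < q) (a : ℝ → ℝ) (f : X) (x : ℝ) :
    weightedNorm (-0) q a (Ioo 0 (Real.exp x)) (fun u => peetreK A₀ A₁ u f) =
      lqNorm q (Iio x) fun u => logWeight a u * logK A₀ A₁ f u := by
  rw [weightedNorm_Ioo_zero_exp hq]
  simp only [neg_zero, zero_mul, eexp_zero, one_mul]
  rfl

/-- At θ = 1 the weight u^{-1} turns K into its reflection, so norms of type 𝓡 become iterated norms
over left half-lines. -/
theorem weightedNorm_Ioi_logK (hq : 0 < q) (a : ℝ → ℝ) (f : X) (x : ℝ) :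
    weightedNorm (-1) q a (Ioi (Real.exp x)) (fun u => peetreK A₀ A₁ u f) =
      lqNorm q (Iio (-x)) fun u => logWeight a (-u) * reflect (logK A₀ A₁ f) u := by
  rw [weightedNorm_Ioi_exp hq, lqNorm_Ioi_eq_neg]
  congr 1
  funext u
  rw [neg_one_mul, neg_neg, reflect, logWeight, logK]
  ring

theorem interpL_eq (hr : 0 < r) (hq : 0 < q) (f : X) :
    interpL A₀ A₁ 0 r b q a f = lqNorm r univ fun s => logWeight b s *
      lqNorm q (Iio s) fun u => logWeight a u * logK A₀ A₁ f u := by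
  rw [interpL, weightedNorm_Ioi_zero hr]
  simp only [weightedNorm_Ioo_logK hq, zero_mul, eexp_zero, one_mul]
  rfl

theorem interpR_eq (hr : 0 < r) (hq : 0 < q) (f : X) :
    interpR A₀ A₁ 1 r b q a f = lqNorm r univ fun s => logWeight b s *
      lqNorm q (Iio (-s)) fun u => logWeight a (-u) * reflect (logK A₀ A₁ f) u := by
  rw [interpR, weightedNorm_Ioi_zero hr]
  simp only [weightedNorm_Ioi_logK hq, zero_mul, eexp_zero, one_mul]
  rfl

theorem interpLL_eq {s : ℝ≥0∞} {c : ℝ → ℝ} (hs : 0 < s) (hr : 0 < r) (hq : 0 < q) (f : X) :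
    interpLL A₀ A₁ 0 s c r b q a f = lqNorm s univ fun t => logWeight c t *
      lqNorm r (Iio t) fun s => logWeight b s *
        lqNorm q (Iio s) fun u => logWeight a u * logK A₀ A₁ f u := by
  rw [interpLL, weightedNorm_Ioi_zero hs]
  simp only [weightedNorm_Ioo_zero_exp hr, weightedNorm_Ioo_logK hq, zero_mul, eexp_zero, one_mul]
  rfl

theorem interpRR_eq {s : ℝ≥0∞} {c : ℝ → ℝ} (hs : 0 < s) (hr : 0 < r) (hq : 0 < q) (f : X) :
    interpRR A₀ A₁ 1 s c r b q a f = lqNorm s univ fun t => logWeight c t *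
      lqNorm r (Iio (-t)) fun s => logWeight b (-s) *
        lqNorm q (Iio s) fun u => logWeight a (-u) * reflect (logK A₀ A₁ f) u := by
  rw [interpRR, weightedNorm_Ioi_zero hs]
  simp only [weightedNorm_Ioi_exp hr, weightedNorm_Ioi_logK hq, zero_mul, eexp_zero, one_mul]
  congr 1
  funext t
  rw [lqNorm_Ioi_eq_neg]
  simp only [neg_neg]
  rfl

end Transfer

end

/-! ### Conclusion: the interpolation formulas for the original spaces -/

theorem theorem46 {𝕜 X : Type*} [RCLike 𝕜] [AddCommGroup X] [Module 𝕜 X]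
    [TopologicalSpace X] [IsTopologicalAddGroup X] [ContinuousSMul 𝕜 X] [T2Space X]
    (A₀ A₁ : X → ℝ≥0∞) (hA : IsCompatibleCouple 𝕜 A₀ A₁)
    (r r₀ q₀ r₁ q₁ : ℝ≥0∞)
    (hr : 0 < r) (hr₀ : 0 < r₀) (hq₀ : 0 < q₀) (hr₁ : 0 < r₁) (hq₁ : 0 < q₁)
    (a a₀ b₀ a₁ b₁ : ℝ → ℝ)
    (ha : SlowlyVarying a) (ha₀ : SlowlyVarying a₀) (hb₀ : SlowlyVarying b₀)
    (ha₁ : SlowlyVarying a₁) (hb₁ : SlowlyVarying b₁)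
    (h₀ : weightedNorm 0 r₀ b₀ (Ioi 1)
      (fun s => weightedNorm 0 q₀ a₀ (Ioo 1 s) fun _ => 1) < ∞)
    (h₁ : weightedNorm 0 r₁ b₁ (Ioo 0 1)
      (fun s => weightedNorm 0 q₁ a₁ (Ioo s 1) fun _ => 1) < ∞)
    (χ₀ χ₁ ρ B₀ B₁ : ℝ → ℝ) (aSharp : ℝ → ℝ → ℝ)
    (hχ₀ : ∀ t, 0 < t → χ₀ t = (weightedNorm 0 r₀ b₀ (Ioi t)
      (fun s => weightedNorm 0 q₀ a₀ (Ioo t s) fun _ => 1)).toReal)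
    (hχ₁ : ∀ t, 0 < t → χ₁ t = (weightedNorm 0 r₁ b₁ (Ioo 0 t)
      (fun s => weightedNorm 0 q₁ a₁ (Ioo s t) fun _ => 1)).toReal)
    (hρ : ∀ t, 0 < t → ρ t = t * (χ₀ t / χ₁ t))
    (hSharp : ∀ θ t, 0 < t → aSharp θ t = χ₀ t ^ (1 - θ) * χ₁ t ^ θ * a (ρ t))
    (hB₀ : ∀ t, 0 < t →
      B₀ t = (weightedNorm 0 r₀ b₀ (Ioi t) fun _ => 1).toReal * a (ρ t))
    (hB₁ : ∀ t, 0 < t →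
      B₁ t = (weightedNorm 0 r₁ b₁ (Ioo 0 t) fun _ => 1).toReal * a (ρ t)) :
    (∀ θ : ℝ, 0 < θ → θ < 1 →
      SameSpace
        (interp (interpL A₀ A₁ 0 r₀ b₀ q₀ a₀) (interpR A₀ A₁ 1 r₁ b₁ q₁ a₁) θ r a)
        (interp A₀ A₁ θ r (aSharp θ))) ∧
    (weightedNorm 0 r a (Ioi 1) (fun _ => 1) < ∞ →
      SameSpace
        (interp (interpL A₀ A₁ 0 r₀ b₀ q₀ a₀) (interpR A₀ A₁ 1 r₁ b₁ q₁ a₁) 0 r a)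
        (interNorm (interNorm (interp A₀ A₁ 0 r (aSharp 0)) (interpL A₀ A₁ 0 r B₀ q₀ a₀))
          (interpLL A₀ A₁ 0 r (a ∘ ρ) r₀ b₀ q₀ a₀))) ∧
    (weightedNorm 0 r a (Ioo 0 1) (fun _ => 1) < ∞ →
      SameSpace
        (interp (interpL A₀ A₁ 0 r₀ b₀ q₀ a₀) (interpR A₀ A₁ 1 r₁ b₁ q₁ a₁) 1 r a)
        (interNorm (interNorm (interp A₀ A₁ 1 r (aSharp 1)) (interpR A₀ A₁ 1 r B₁ q₁ a₁))
          (interpRR A₀ A₁ 1 r (a ∘ ρ) r₁ b₁ q₁ a₁))) := by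
  have hfin₀ : tailIterNorm r₀ (logWeight b₀) q₀ (logWeight a₀) 0 ≠ ∞ := by
    rw [tailIterNorm_logWeight hr₀ hq₀, Real.exp_zero]
    exact h₀.ne
  have hfin₁ : tailIterNorm r₁ (fun x => logWeight b₁ (-x)) q₁ (fun x => logWeight a₁ (-x)) (-0) ≠
      ∞ := by
    rw [tailIterNorm_logWeight_neg hr₁ hq₁, Real.exp_zero]
    exact h₁.ne
  let D : IterData := ⟨r₀, logWeight b₀, q₀, logWeight a₀, hr₀, hq₀, hb₀.slow, ha₀.slow,
    hb₀.logWeight_ne_zero, ha₀.logWeight_ne_zero, _, hfin₀⟩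
  -- The weights of Y₁ are reflected, so that E.chi (-x) is χ₁(e^x).
  let E : IterData := ⟨r₁, fun x => logWeight b₁ (-x), q₁, fun x => logWeight a₁ (-x), hr₁, hq₁,
    hb₁.slow.comp_neg, ha₁.slow.comp_neg, fun x => hb₁.logWeight_ne_zero (-x),
    fun x => ha₁.logWeight_ne_zero (-x), _, hfin₁⟩
  have hY₀ : interpL A₀ A₁ 0 r₀ b₀ q₀ a₀ = fun f => D.norm (logK A₀ A₁ f) :=
    funext fun f => interpL_eq hr₀ hq₀ f
  have hY₁ : interpR A₀ A₁ 1 r₁ b₁ q₁ a₁ = fun f => E.norm (reflect (logK A₀ A₁ f)) := by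
    funext f
    rw [interpR_eq hr₁ hq₁ f, ← lqNorm_univ_comp_neg]
    simp only [neg_neg]
    rfl
  have hD : ∀ x, (D.chi x).toReal = χ₀ (Real.exp x) := fun x => by
    rw [hχ₀ _ (Real.exp_pos x), ← tailIterNorm_logWeight hr₀ hq₀]
    rfl
  have hE : ∀ x, (E.chi (-x)).toReal = χ₁ (Real.exp x) := fun x => by
    rw [hχ₁ _ (Real.exp_pos x), ← tailIterNorm_logWeight_neg hr₁ hq₁]
    rfl
  have hD' : ∀ x, D.chi x = ENNReal.ofReal (χ₀ (Real.exp x)) := fun x => by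
    rw [← hD, ENNReal.ofReal_toReal (D.chi_ne_top x)]
  have hE' : ∀ x, E.chi (-x) = ENNReal.ofReal (χ₁ (Real.exp x)) := fun x => by
    rw [← hE, ENNReal.ofReal_toReal (E.chi_ne_top (-x))]
  have hpos₀ : ∀ x, 0 < χ₀ (Real.exp x) := fun x => by
    rw [← hD]
    exact ENNReal.toReal_pos (D.chi_ne_zero x) (D.chi_ne_top x)
  have hpos₁ : ∀ x, 0 < χ₁ (Real.exp x) := fun x => by
    rw [← hE]
    exact ENNReal.toReal_pos (E.chi_ne_zero (-x)) (E.chi_ne_top (-x))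
  let p : ℝ → ℝ := fun x => x + (Real.log (χ₀ (Real.exp x)) - Real.log (χ₁ (Real.exp x)))
  have hpρ : ∀ x, Real.exp (p x) = ρ (Real.exp x) := fun x => by
    rw [hρ _ (Real.exp_pos x), Real.exp_add, Real.exp_sub, Real.exp_log (hpos₀ x),
      Real.exp_log (hpos₁ x)]
  have hp : IsLogRatio D E p := fun x => by
    rw [hD', hE', eexp, eexp, hpρ, hρ _ (Real.exp_pos x), ← ENNReal.ofReal_mul,
      ← ENNReal.ofReal_mul (Real.exp_pos x).le, mul_assoc, div_mul_cancel₀ _ (hpos₁ x).ne']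
    exact mul_nonneg (Real.exp_pos x).le (div_nonneg (hpos₀ x).le (hpos₁ x).le)
  -- Here p x - x is the difference of the logarithms of χ₀ and χ₁, and each contributes ε / 2.
  have ht : AlmostTranslation p := by
    intro ε hε
    obtain ⟨c, hc, h⟩ := D.slow_chi.exists_abs_log_sub_le D.chi_ne_zero D.chi_ne_top (half_pos hε)
    obtain ⟨c', hc', h'⟩ := E.slow_chi.comp_neg.exists_abs_log_sub_le
      (fun x => E.chi_ne_zero (-x)) (fun x => E.chi_ne_top (-x)) (half_pos hε)
    refine ⟨c + c', by positivity, fun x y => ?_⟩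
    have e1 := h x y
    have e2 := h' x y
    rw [hD, hD] at e1
    rw [hE, hE] at e2
    simp only [p, add_sub_cancel_left]
    rw [abs_le] at e1 e2 ⊢
    constructor <;> linarith [e1.1, e1.2, e2.1, e2.2]
  have haρ : ∀ x, logWeight a (p x) = ENNReal.ofReal (a (ρ (Real.exp x))) := fun x => by
    rw [logWeight, hpρ]
  -- Since e^{p(x)} = e^x χ₀ / χ₁, the product e^{-θ p} χ₀ equals e^{-θ x} χ₀^{1-θ} χ₁^θ; this is
  -- where the weight a^# comes from.
  have hcommon : ∀ θ, commonPart A₀ A₁ D p θ r (logWeight a) = interp A₀ A₁ θ r (aSharp θ) := by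
    intro θ
    rw [interp_eq_logInterp hr]
    funext f
    unfold commonPart logInterp
    congr 1
    funext x
    rw [haρ, hD', logWeight, hSharp θ _ (Real.exp_pos x), ← mul_assoc]
    congr 1
    rw [eexp, eexp, ← ENNReal.ofReal_mul (Real.exp_pos _).le,
      ← ENNReal.ofReal_mul' (hpos₀ x).le, ← ENNReal.ofReal_mul (Real.exp_pos _).le,
      Real.rpow_def_of_pos (hpos₀ x), Real.rpow_def_of_pos (hpos₁ x)]
    congr 1
    have hexp : Real.exp (-(θ * p x)) * Real.exp (Real.log (χ₀ (Real.exp x))) =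
        Real.exp (-(θ * x)) * (Real.exp (Real.log (χ₀ (Real.exp x)) * (1 - θ)) *
          Real.exp (Real.log (χ₁ (Real.exp x)) * θ)) := by
      rw [← Real.exp_add, ← Real.exp_add, ← Real.exp_add]
      congr 1
      simp only [p]
      ring
    rw [Real.exp_log (hpos₀ x)] at hexp
    rw [mul_right_comm, hexp, mul_assoc]
  rw [hY₀, hY₁]
  simp only [interp_eq_logInterp hr _ _ _ a, ← hcommon]
  refine ⟨fun θ hθ hθ' => sameSpace_commonPart hA hr ha.slow ht hp hθ hθ', fun _ => ?_, fun _ => ?_⟩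
  · convert! sameSpace_left hA hr ha.slow ht hp using 2
    · congr 1
      funext f
      rw [interpL_eq hr hq₀]
      congr 1
      funext x
      rw [haρ, logWeight, hB₀ _ (Real.exp_pos x), ← tailNorm_logWeight hr₀,
        ENNReal.ofReal_mul ENNReal.toReal_nonneg, ENNReal.ofReal_toReal
        (D.slow_β.tailNorm_ne_top hr₀ hq₀ D.slow_α D.α_ne_zero (D.chi_ne_top x)), mul_right_comm,
        mul_comm]
      rfl
    · funext f
      rw [interpLL_eq hr hr₀ hq₀]
      congr 1
      funext x
      rw [haρ]
      rfl
  · convert! sameSpace_right hA hr ha.slow ht hp using 2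
    · congr 1
      funext f
      rw [interpR_eq hr hq₁]
      congr 1
      funext x
      rw [haρ, logWeight, hB₁ _ (Real.exp_pos x), ← tailNorm_logWeight_neg hr₁,
        ENNReal.ofReal_mul ENNReal.toReal_nonneg, ENNReal.ofReal_toReal
        (E.slow_β.tailNorm_ne_top hr₁ hq₁ E.slow_α E.α_ne_zero (E.chi_ne_top (-x))), mul_right_comm,
        mul_comm]
      rfl
    · funext f
      rw [interpRR_eq hr hr₁ hq₁]
      congr 1
      funext x
      rw [haρ]
      rfl
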